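/- A single item is sold to one of $n$ bidders. The type profile $(\theta_1,\dots,\theta_n)$ is drawn from a common prior $\mathcal P$, possibly correlated; $\theta_i$ is known only to bidder $i$ and determines her inspection cost $c_i(\theta_i)\ge 0$ and the distribution $F_{\theta_i}$ of her value $v_i\in\mathbb R$. Given the type profile the values are independent. Bidder $i$ may at any time privately inspect, paying $c_i$ and learning $v_i$; inspection is mandatory to obtain the item. With $A_i$ and $I_i$ the indicators that $i$ obtains the item and that $i$ inspects, and $t_i$ her payment, her utility is $A_iv_i-I_ic_i-t_i$, and welfare is $\sum_i(A_iv_i-I_ic_i)$. Assume that $v_i^+=\max\{v_i,0\}$ has finite expectation, ex ante and given each type. The strike price $\sigma_i$ of bidder $i$ with type $\theta_i$ is the unique solution of $\mathbb E_{F_{\theta_i}}[(v_i-\sigma_i)^+]=c_i(\theta_i)$ if $c_i(\theta_i)>0$, and $\sigma_i=\infty$ if $c_i(\theta_i)=0$. Her covered call value is $\kappa_i=\min\{\sigma_i,v_i\}$. In the Dutch auction a clock descends continuously from $\infty$ to $0$; as long as the item is available, any bidder may claim it at the current clock value, which ends the auction, and bidders observe nothing else about each other. Simultaneous claims are resolved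 uniformly at random; a bidder who chooses to inspect at the very clock value at which the item is claimed has paid for her inspection. Strategies may be randomized, and equilibrium means Bayes-Nash equilibrium. An equilibrium is symmetric if all bidders' claim prices (the clock value at which a bidder claims the item if it is still available, or "never") are given by one common, possibly randomized, function of the covered call value, i.e. the conditional law of the claim price given $\kappa_i$ is the same for every $i$. The optimal welfare is the supremum of the expected welfare over all (adaptive, possibly randomized) centralized procedures of a planner who knows all types and learns values only through costly inspection. A strategy profile is efficient if no such procedure has higher expected welfare. 1. If $\kappa_1,\dots,\kappa_n$ are identically distributed and the types $\theta_1,\dots,\theta_n$ are independent, then every symmetric equilibrium of the Dutch auction is efficient. 2. Without any symmetry or independence assumption (types may be arbitrarily correlated), the expected welfare of every equilibrium of the Dutch auction is at least $1-\frac1e$ times the optimal welfare. -/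

import Mathlib

open MeasureTheory ProbabilityTheory

noncomputable section

namespace DutchInspection

universe u

/-! ## Extended expectation, strike price, covered call value -/

/-- Expectation in the extended reals, `E[X⁺] - E[X⁻]`. In every use below `E[X⁺]` is finite, so
that the value is the usual one, possibly `-∞`. -/
def expect {Ω : Type*} [MeasurableSpace Ω] (μ : Measure Ω) (X : Ω → ℝ) : EReal :=
  ((∫⁻ ω, ENNReal.ofReal (X ω) ∂μ : ENNReal) : EReal)
    - ((∫⁻ ω, ENNReal.ofReal (-X ω) ∂μ : ENNReal) : EReal)

/-- The strike price for value distribution `F` and inspection cost `c`: the highest price `x` with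
`c ≤ E[(v - x)⁺]`. For `c > 0` it is the unique solution of `E[(v - x)⁺] = c`
(`strikePrice_eq_of_solution`, `existsUnique_strikePrice`); for `c = 0` it is `⊤`
(`strikePrice_zero`). -/
def strikePrice (F : Measure ℝ) (c : ℝ) : EReal :=
  ⨆ x ∈ {x : ℝ | c ≤ ∫ v, max (v - x) 0 ∂F}, (x : EReal)

/-- The covered call value `min {σ, v}`. -/
def coveredCall (F : Measure ℝ) (c : ℝ) (v : ℝ) : EReal :=
  min (strikePrice F c) (v : EReal)

theorem integrable_call {F : Measure ℝ} [IsFiniteMeasure F]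
    (hF : Integrable (fun v : ℝ => max v 0) F) (x : ℝ) :
    Integrable (fun v : ℝ => max (v - x) 0) F := by
  refine Integrable.mono' (hF.add (integrable_const |x|)) (by fun_prop) ?_
  filter_upwards with v
  rw [Real.norm_eq_abs, abs_of_nonneg (le_max_right _ _)]
  refine max_le ?_ ?_
  · have h1 := le_max_left v 0
    have h2 := neg_abs_le x
    simp only [Pi.add_apply]
    linarith
  · have h1 := le_max_right v 0
    have h2 := abs_nonneg x
    simp only [Pi.add_apply]
    linarith

theorem call_mono {F : Measure ℝ} [IsFiniteMeasure F]
    (hF : Integrable (fun v : ℝ => max v 0) F) {x y : ℝ} (h : x ≤ y) :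
    ∫ v, max (v - y) 0 ∂F ≤ ∫ v, max (v - x) 0 ∂F :=
  integral_mono (integrable_call hF y) (integrable_call hF x)
    (fun v => max_le_max (by linarith) le_rfl)

theorem strikePrice_eq_of_solution {F : Measure ℝ} [IsProbabilityMeasure F]
    (hF : Integrable (fun v : ℝ => max v 0) F) {c x : ℝ} (hc : 0 < c)
    (hx : ∫ v, max (v - x) 0 ∂F = c) : strikePrice F c = (x : EReal) := by
  apply le_antisymm
  · refine iSup₂_le fun y hy => ?_
    rw [EReal.coe_le_coe_iff]
    by_contra! hxy
    have hy' : c ≤ ∫ v, max (v - y) 0 ∂F := hy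
    have heq : ∫ v, (max (v - x) 0 - max (v - y) 0) ∂F = 0 := by
      rw [integral_sub (integrable_call hF x) (integrable_call hF y)]
      linarith [call_mono hF hxy.le]
    rw [integral_eq_zero_iff_of_nonneg
      (fun v => sub_nonneg.2 (max_le_max (by linarith) le_rfl))
      ((integrable_call hF x).sub (integrable_call hF y))] at heq
    have h0 : ∫ v, max (v - x) 0 ∂F = 0 := by
      refine integral_eq_zero_of_ae ?_
      filter_upwards [heq] with v hv
      simp only [Pi.zero_apply] at hv ⊢
      by_contra hne
      have hpos : 0 < v - x := by
        by_contra! hle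
        exact hne (max_eq_right hle)
      rw [max_eq_left hpos.le] at hv
      have : max (v - y) 0 < v - x := max_lt (by linarith) hpos
      linarith
    linarith
  · exact le_iSup₂_of_le x (by simp [hx]) le_rfl

theorem strikePrice_zero (F : Measure ℝ) : strikePrice F 0 = ⊤ := by
  refine (EReal.eq_top_iff_forall_lt _).2 fun x => ?_
  have h0 : (0 : ℝ) ≤ ∫ v, max (v - (x + 1)) 0 ∂F :=
    integral_nonneg fun v => le_max_right (v - (x + 1)) 0
  have hx : ((x : ℝ) : EReal) < ((x + 1 : ℝ) : EReal) := by
    rw [EReal.coe_lt_coe_iff]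
    linarith
  exact hx.trans_le (le_iSup₂_of_le (x + 1) h0 le_rfl)

theorem continuous_call {F : Measure ℝ} [IsProbabilityMeasure F]
    (hF : Integrable (fun v : ℝ => max v 0) F) :
    Continuous fun x : ℝ => ∫ v, max (v - x) 0 ∂F := by
  refine (LipschitzWith.of_dist_le_mul (K := 1) fun x y => ?_).continuous
  rw [Real.dist_eq, Real.dist_eq, ← integral_sub (integrable_call hF x) (integrable_call hF y)]
  have h := norm_integral_le_of_norm_le_const (μ := F) (C := |x - y|)
    (f := fun v => max (v - x) 0 - max (v - y) 0) (Filter.Eventually.of_forall fun v => by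
      refine (abs_max_sub_max_le_abs _ _ _).trans (le_of_eq ?_)
      rw [abs_sub_comm x y]
      ring_nf)
  simpa using h

theorem existsUnique_strikePrice {F : Measure ℝ} [IsProbabilityMeasure F]
    (hF : Integrable (fun v : ℝ => max v 0) F) {c : ℝ} (hc : 0 < c) :
    ∃! x : ℝ, ∫ v, max (v - x) 0 ∂F = c := by
  have hlow : ∃ x : ℝ, ∫ v, max (v - x) 0 ∂F ≤ c := by
    have ht : Filter.Tendsto (fun m : ℕ => ∫ v, max (v - (m : ℝ)) 0 ∂F) Filter.atTop
        (nhds (∫ _, (0 : ℝ) ∂F)) := by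
      refine tendsto_integral_of_dominated_convergence (fun v => max v 0)
        (fun m => (integrable_call hF m).aestronglyMeasurable) hF (fun m => ?_) ?_
      · filter_upwards with v
        rw [Real.norm_eq_abs, abs_of_nonneg (le_max_right _ _)]
        exact max_le_max (by linarith [Nat.cast_nonneg (α := ℝ) m]) le_rfl
      · filter_upwards with v
        refine tendsto_const_nhds.congr' ?_
        filter_upwards [Filter.eventually_ge_atTop ⌈v⌉₊] with m hm
        exact (max_eq_right (by linarith [Nat.le_ceil v, (Nat.cast_le (α := ℝ)).2 hm])).symm
    simp only [integral_zero] at ht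
    obtain ⟨m, hm⟩ := (ht.eventually (eventually_le_nhds hc)).exists
    exact ⟨m, hm⟩
  have hhigh : ∃ x : ℝ, c ≤ ∫ v, max (v - x) 0 ∂F := by
    obtain ⟨m, hm⟩ : ∃ m : ℕ, F (Set.Ici (-(m : ℝ))) ≠ 0 := by
      by_contra! h
      have hU : (⋃ m : ℕ, Set.Ici (-(m : ℝ))) = Set.univ := by
        refine Set.eq_univ_of_forall fun v => Set.mem_iUnion.2 ⟨⌈-v⌉₊, ?_⟩
        simp only [Set.mem_Ici]
        linarith [Nat.le_ceil (-v)]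
      have h0 := measure_iUnion_null h
      rw [hU, measure_univ] at h0
      exact one_ne_zero h0
    have hp : 0 < F.real (Set.Ici (-(m : ℝ))) :=
      ENNReal.toReal_pos hm (measure_ne_top _ _)
    refine ⟨-(m : ℝ) - c / F.real (Set.Ici (-(m : ℝ))), ?_⟩
    have hle : ∫ v, (Set.Ici (-(m : ℝ))).indicator
        (fun _ => c / F.real (Set.Ici (-(m : ℝ)))) v ∂F
        ≤ ∫ v, max (v - (-(m : ℝ) - c / F.real (Set.Ici (-(m : ℝ))))) 0 ∂F := by
      refine integral_mono ((integrable_const _).indicator measurableSet_Ici)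
        (integrable_call hF _) fun v => ?_
      simp only [Set.indicator_apply, Set.mem_Ici]
      split_ifs with hv
      · exact le_max_of_le_left (by linarith)
      · exact le_max_right _ _
    rw [integral_indicator_const _ measurableSet_Ici, smul_eq_mul, mul_div_cancel₀ _ hp.ne'] at hle
    exact hle
  obtain ⟨x, hx⟩ := mem_range_of_exists_le_of_exists_ge (continuous_call hF) hlow hhigh
  refine ⟨x, hx, fun y hy => ?_⟩
  have h := (strikePrice_eq_of_solution hF hc hy).symm.trans (strikePrice_eq_of_solution hF hc hx)
  exact_mod_cast h

/-- The supremum in the definition of the strike price may be taken over the rationals. -/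
theorem strikePrice_eq_iSup_rat {F : Measure ℝ} [IsProbabilityMeasure F]
    (hF : Integrable (fun v : ℝ => max v 0) F) (c : ℝ) :
    strikePrice F c = ⨆ q : ℚ, ⨆ _ : c ≤ ∫ v, max (v - (q : ℝ)) 0 ∂F, (((q : ℝ)) : EReal) := by
  apply le_antisymm
  · refine iSup₂_le fun x hx => le_of_forall_lt fun a ha => ?_
    obtain ⟨q, hq1, hq2⟩ := EReal.exists_rat_btwn_of_lt ha
    have hqx : (q : ℝ) ≤ x := by exact_mod_cast hq2.le
    exact hq1.trans_le (le_iSup₂_of_le q (le_trans hx (call_mono hF hqx)) le_rfl)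
  · exact iSup₂_le fun q hq => le_iSup₂_of_le (q : ℝ) hq le_rfl

/-! ## The environment -/

/-- `n` bidders; `Θ i` is bidder `i`'s type space. -/
structure Environment (n : ℕ) (Θ : Fin n → Type u) [∀ i, MeasurableSpace (Θ i)] where
  /-- the common prior over type profiles (arbitrarily correlated) -/
  prior : Measure (∀ i, Θ i)
  isProb : IsProbabilityMeasure prior
  /-- `F i t` is the value distribution of bidder `i` when her type is `t` -/
  F : ∀ i, Kernel (Θ i) ℝ
  isMarkov : ∀ i, IsMarkovKernel (F i)
  /-- the inspection cost of bidder `i` as a function of her type -/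
  cost : ∀ i, Θ i → ℝ
  measurable_cost : ∀ i, Measurable (cost i)
  cost_nonneg : ∀ i t, 0 ≤ cost i t
  /-- the conditional expectation of `v⁺` given the type is finite -/
  integrable_type : ∀ i t, Integrable (fun v : ℝ => max v 0) (F i t)
  /-- the ex ante expectation of `v⁺` is finite -/
  integrable_exAnte : ∀ i, Integrable (fun p : (∀ i, Θ i) × ℝ => max p.2 0)
    (prior ⊗ₘ ((F i).comap (fun θ : ∀ i, Θ i => θ i) (measurable_pi_apply i)))

namespace Environment

variable {n : ℕ} {Θ : Fin n → Type u} [∀ i, MeasurableSpace (Θ i)]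

instance (E : Environment n Θ) : IsProbabilityMeasure E.prior := E.isProb

instance (E : Environment n Θ) (i : Fin n) : IsMarkovKernel (E.F i) := E.isMarkov i

/-- Given the type profile, the values are independent, `v i` having law `F i (θ i)`. -/
def valueKernel (E : Environment n Θ) : Kernel (∀ i, Θ i) (Fin n → ℝ) where
  toFun θ := Measure.pi fun i => E.F i (θ i)
  measurable' := by
    refine Measurable.measure_of_isPiSystem_of_isProbabilityMeasure
      (S := Set.pi Set.univ '' Set.pi Set.univ fun _ => {s : Set ℝ | MeasurableSet s})
      generateFrom_pi.symm isPiSystem_pi ?_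
    rintro _ ⟨s, hs, rfl⟩
    simp only [Measure.pi_pi]
    exact Finset.measurable_fun_prod _ fun i _ =>
      (Kernel.measurable_coe (E.F i) (hs i (Set.mem_univ i))).comp (measurable_pi_apply i)

/-- The joint law of the type profile and the value profile. -/
def law (E : Environment n Θ) : Measure ((∀ i, Θ i) × (Fin n → ℝ)) :=
  E.prior ⊗ₘ E.valueKernel

/-- Bidder `i`'s covered call value as a function of her type and value. -/
def kappa (E : Environment n Θ) (i : Fin n) (t : Θ i) (v : ℝ) : EReal :=
  coveredCall (E.F i t) (E.cost i t) v

theorem measurable_kappa (E : Environment n Θ) (i : Fin n) :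
    Measurable fun x : Θ i × ℝ => E.kappa i x.1 x.2 := by
  have hs : Measurable fun t : Θ i => strikePrice (E.F i t) (E.cost i t) := by
    simp only [fun t => strikePrice_eq_iSup_rat (E.integrable_type i t) (E.cost i t)]
    refine Measurable.iSup fun q => ?_
    have hg : Measurable fun t : Θ i => ∫ v, max (v - (q : ℝ)) 0 ∂(E.F i t) :=
      (StronglyMeasurable.integral_kernel (κ := E.F i)
        (f := fun v : ℝ => max (v - (q : ℝ)) 0)
        (Measurable.stronglyMeasurable (by fun_prop))).measurable
    have hset := measurableSet_le (E.measurable_cost i) hg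
    classical
    have hite : Measurable fun t : Θ i =>
        if E.cost i t ≤ ∫ v, max (v - (q : ℝ)) 0 ∂(E.F i t) then (((q : ℝ)) : EReal) else ⊥ :=
      Measurable.ite hset measurable_const measurable_const
    convert hite using 2 with t
    split_ifs with h <;> simp [h]
  exact (hs.comp measurable_fst).min (measurable_coe_real_ereal.comp measurable_snd)

/-- The (ex ante) distribution of bidder `i`'s covered call value. -/
def kappaLaw (E : Environment n Θ) (i : Fin n) : Measure EReal :=
  E.law.map fun p => E.kappa i (p.1 i) (p.2 i)

/-! ## Centralized procedures and the first best -/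

end Environment

/-- The observed values: the value of every inspected bidder, and `0` elsewhere. -/
def observed {n : ℕ} (S : Finset (Fin n)) (v : Fin n → ℝ) : Fin n → ℝ :=
  fun j => if j ∈ S then v j else 0

/-- A centralized procedure of a planner who knows the type profile and may randomize with the help
of a seed. When `S` is the set of bidders inspected so far and `w` are the observed values,
`next S r θ w` is the bidder to be inspected next (`none`: stop inspecting). When inspection has
ended, `award S r θ w` is the bidder who receives the item (`none`: nobody does). -/
structure Procedure (n : ℕ) (Θ : Fin n → Type u) [∀ i, MeasurableSpace (Θ i)] where
  next : Finset (Fin n) → unitInterval → (∀ i, Θ i) → (Fin n → ℝ) → Option (Fin n)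
  award : Finset (Fin n) → unitInterval → (∀ i, Θ i) → (Fin n → ℝ) → Option (Fin n)
  measurable_next : ∀ S o, MeasurableSet
    {x : unitInterval × (∀ i, Θ i) × (Fin n → ℝ) | next S x.1 x.2.1 x.2.2 = o}
  measurable_award : ∀ S o, MeasurableSet
    {x : unitInterval × (∀ i, Θ i) × (Fin n → ℝ) | award S x.1 x.2.1 x.2.2 = o}

namespace Procedure

variable {n : ℕ} {Θ : Fin n → Type u} [∀ i, MeasurableSpace (Θ i)]

/-- The set of bidders inspected during the first `k` steps. -/
def inspectedAfter (π : Procedure n Θ) (r : unitInterval) (θ : ∀ i, Θ i) (v : Fin n → ℝ) :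
    ℕ → Finset (Fin n)
  | 0 => ∅
  | k + 1 =>
    match π.next (π.inspectedAfter r θ v k) r θ (observed (π.inspectedAfter r θ v k) v) with
    | none => π.inspectedAfter r θ v k
    | some j => insert j (π.inspectedAfter r θ v k)

/-- The bidder who receives the item; inspection has ended after at most `n` steps. -/
def winner (π : Procedure n Θ) (r : unitInterval) (θ : ∀ i, Θ i) (v : Fin n → ℝ) :
    Option (Fin n) :=
  π.award (π.inspectedAfter r θ v n) r θ (observed (π.inspectedAfter r θ v n) v)

/-- The bidders whose inspection cost is paid: those inspected before the award, and the winner,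
for whom inspection is mandatory. -/
def payers (π : Procedure n Θ) (r : unitInterval) (θ : ∀ i, Θ i) (v : Fin n → ℝ) :
    Finset (Fin n) :=
  π.inspectedAfter r θ v n ∪ (π.winner r θ v).toFinset

/-- Expected welfare `E[∑ i, (A i * v i - I i * c i)]` of a procedure. -/
def welfare (E : Environment n Θ) (π : Procedure n Θ) : EReal :=
  expect (E.law.prod (volume : Measure unitInterval)) fun ω =>
    ∑ i, ((if π.winner ω.2 ω.1.1 ω.1.2 = some i then ω.1.2 i else 0)
      - (if i ∈ π.payers ω.2 ω.1.1 ω.1.2 then E.cost i (ω.1.1 i) else 0))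

end Procedure

/-- The first-best welfare: the highest expected welfare of any procedure. -/
def optimalWelfare {n : ℕ} {Θ : Fin n → Type u} [∀ i, MeasurableSpace (Θ i)]
    (E : Environment n Θ) : EReal :=
  ⨆ π : Procedure n Θ, π.welfare E

/-! ## The Dutch auction -/

/-- A (mixed) strategy of a bidder with type space `T` in the Dutch auction, in which the clock
descends from `∞` to `0`. As long as nobody has claimed the item, the bidder, who has type `t` and
a private randomization seed `r`, inspects when the clock is at `inspectAt t r` and then, her value
being `v`, claims the item at the first clock value, from the inspection on, that is at most
`claimAt t v r`. A negative threshold is never reached. That nobody has claimed yet is the only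
thing a bidder learns about her opponents while the auction runs, so that nothing else can
influence her behaviour. -/
structure Strategy (T : Type u) [MeasurableSpace T] where
  inspectAt : T → unitInterval → EReal
  claimAt : T → ℝ → unitInterval → EReal
  claimAt_lt_top : ∀ t v r, claimAt t v r < ⊤
  measurable_inspectAt : Measurable fun x : T × unitInterval => inspectAt x.1 x.2
  measurable_claimAt : Measurable fun x : T × ℝ × unitInterval => claimAt x.1 x.2.1 x.2.2

/-- The clock value at which a bidder claims the item if it is still available; `⊥` if she never
does. -/
def Strategy.bid {T : Type u} [MeasurableSpace T] (s : Strategy T)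
    (t : T) (v : ℝ) (r : unitInterval) : EReal :=
  if 0 ≤ min (s.inspectAt t r) (s.claimAt t v r) then min (s.inspectAt t r) (s.claimAt t v r)
  else ⊥

open Classical in
/-- The probability that bidder `i` wins, given everybody's claim prices: the highest claim price
wins, and ties are broken uniformly at random. -/
def winProb {n : ℕ} (b : Fin n → EReal) (i : Fin n) : ℝ :=
  if 0 ≤ b i ∧ ∀ j, b j ≤ b i then 1 / ((Finset.univ.filter fun j => b j = b i).card : ℝ) else 0

namespace Environment

variable {n : ℕ} {Θ : Fin n → Type u} [∀ i, MeasurableSpace (Θ i)]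

/-- The sample space of the auction: types and values, and the private seeds of the bidders, which
are independent of everything else. -/
def auctionLaw (E : Environment n Θ) :
    Measure (((∀ i, Θ i) × (Fin n → ℝ)) × (Fin n → unitInterval)) :=
  E.law.prod (Measure.pi fun _ => (volume : Measure unitInterval))

end Environment

section Auction

variable {n : ℕ} {Θ : Fin n → Type u} [∀ i, MeasurableSpace (Θ i)]

/-- The claim price of bidder `i` at a sample point. -/
def bidAt (s : ∀ i, Strategy (Θ i))
    (ω : ((∀ i, Θ i) × (Fin n → ℝ)) × (Fin n → unitInterval)) (i : Fin n) : EReal :=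
  (s i).bid (ω.1.1 i) (ω.1.2 i) (ω.2 i)

/-- Bidder `i` inspects: the clock reaches her inspection price, that is, nobody has claimed the
item at a strictly higher price. -/
def Inspects (s : ∀ i, Strategy (Θ i))
    (ω : ((∀ i, Θ i) × (Fin n → ℝ)) × (Fin n → unitInterval)) (i : Fin n) : Prop :=
  0 ≤ (s i).inspectAt (ω.1.1 i) (ω.2 i) ∧ ∀ j, bidAt s ω j ≤ (s i).inspectAt (ω.1.1 i) (ω.2 i)

open Classical in
/-- The inspection cost paid by bidder `i`. -/
def costPaid (E : Environment n Θ) (s : ∀ i, Strategy (Θ i))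
    (ω : ((∀ i, Θ i) × (Fin n → ℝ)) × (Fin n → unitInterval)) (i : Fin n) : ℝ :=
  if Inspects s ω i then E.cost i (ω.1.1 i) else 0

/-- Expected utility `E[A i * v i - I i * c i - t i]` of bidder `i`; the winner pays the clock value
at which she claims. -/
def utility (E : Environment n Θ) (s : ∀ i, Strategy (Θ i)) (i : Fin n) : EReal :=
  expect E.auctionLaw fun ω =>
    winProb (bidAt s ω) i * (ω.1.2 i - (bidAt s ω i).toReal) - costPaid E s ω i

/-- Bayes-Nash equilibrium of the Dutch auction: no bidder gains from a unilateral deviation. -/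
def IsEquilibrium (E : Environment n Θ) (s : ∀ i, Strategy (Θ i)) : Prop :=
  ∀ (i : Fin n) (s' : Strategy (Θ i)), utility E (Function.update s i s') i ≤ utility E s i

/-- Expected welfare `E[∑ i, (A i * v i - I i * c i)]` of the Dutch auction. -/
def auctionWelfare (E : Environment n Θ) (s : ∀ i, Strategy (Θ i)) : EReal :=
  expect E.auctionLaw fun ω =>
    ∑ i, (winProb (bidAt s ω) i * ω.1.2 i - costPaid E s ω i)

/-- The strategy profile is symmetric: one common (possibly randomized) function `β` from the
covered call value to the claim price describes the behaviour of every bidder. -/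
def IsSymmetric (E : Environment n Θ) (s : ∀ i, Strategy (Θ i)) : Prop :=
  ∃ β : Kernel EReal EReal, IsMarkovKernel β ∧ ∀ i,
    E.auctionLaw.map (fun ω => (E.kappa i (ω.1.1 i) (ω.1.2 i), bidAt s ω i)) = E.kappaLaw i ⊗ₘ β

/-- The strategy profile is efficient: no procedure achieves a higher welfare. -/
def IsEfficient (E : Environment n Θ) (s : ∀ i, Strategy (Θ i)) : Prop :=
  optimalWelfare E ≤ auctionWelfare E s

end Auction

end DutchInspection

end

noncomputable section

namespace DutchInspection

universe u

/-! ## Extended expectations -/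

section Expect

variable {Ω : Type*} [MeasurableSpace Ω] {μ : Measure Ω} {X Y : Ω → ℝ}

/-! The Dutch auction behaves like a first-price auction in which bidder `i` has value `κ i` and
inspection is free. The reason is an amortization: given the type, `v - κ = (v - σ)⁺` has mean equal
to the inspection cost (`lintegral_sub_callValue`). The decision to inspect cannot depend on a value
not yet seen, so `I c` may be replaced by `I (v - κ)` in expectation (`expect_cost_eq`). As `A ≤ I`,
the result `A v - I (v - κ)` is at most `A κ`, and the loss `(I - A)(v - κ)` arises only when a
bidder inspects, finds `v > σ` and fails to obtain the item for certain. For a planner this bounds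
welfare by the expectation of the positive part of `max κ` (`Procedure.welfare_le`). In the auction
a bidder avoids the loss by inspecting at `φ σ` and claiming at `φ v`, with `φ` monotone: her claim
price is `φ κ`, and barring ties she earns `κ - φ κ` exactly when nobody else claims first
(`outrightGain_le_callPayoff`).

For the factor `1 - 1/e`, let each bidder deviate to the claim price `(1 - exp (-r)) κ` with `r`
uniform. Against a highest competing price `p` this yields at least `(1 - 1/e) κ - p` in expectation
over `r` (`le_lintegral_shade`). Applied to the bidder with the highest `κ`, it shows that utilities
sum to at least `(1 - 1/e) E[bestCall]` minus revenue. Welfare is utilities plus revenue, so revenue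
cancels. The argument is made pointwise in types and values, so correlation is harmless.

For efficiency, symmetry and independence make the pairs `(κ i, b i)` i.i.d. with a law `μ`. Let `H
y` be the probability that the other `n - 1` prices are at most `y`. Deviations on a dense set of
prices that are not atoms of the bid distribution secure, in expectation, the supremum over `y` of
`(κ - y)⁺ H y`. Equilibrium utility is in turn at most the value of the bids actually made when all
ties are won, which is pointwise at most this supremum. Hence everything is an equality almost
surely: no amortization loss occurs, a tied winner has `κ = b`, and every bid is a best response to
`H` (`callPayoff_ae_eq_tiePayoff`, `tieValue_ae_eq`). Single crossing then makes the winner a bidder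
with the highest `κ` (`ae_winner_best`), and the item stays unsold only if no `κ` is positive
(`ae_unsold`), so the first-best bound is attained. -/

theorem expect_of_nonneg (hX : ∀ ω, 0 ≤ X ω) :
    expect μ X = ((∫⁻ ω, ENNReal.ofReal (X ω) ∂μ : ENNReal) : EReal) := by
  have : ∀ ω, ENNReal.ofReal (-X ω) = 0 := fun ω => ENNReal.ofReal_of_nonpos (by linarith [hX ω])
  simp [expect, this]

theorem expect_mono_ae (h : ∀ᵐ ω ∂μ, X ω ≤ Y ω) : expect μ X ≤ expect μ Y := by
  refine EReal.sub_le_sub ?_ ?_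
  · exact EReal.coe_ennreal_le_coe_ennreal_iff.2
      (lintegral_mono_ae (h.mono fun ω hω => ENNReal.ofReal_le_ofReal hω))
  · exact EReal.coe_ennreal_le_coe_ennreal_iff.2
      (lintegral_mono_ae (h.mono fun ω hω => ENNReal.ofReal_le_ofReal (neg_le_neg hω)))

theorem lintegral_ofReal_ne_top_of_le (hY : Integrable Y μ) (h : ∀ ω, X ω ≤ Y ω) :
    ∫⁻ ω, ENNReal.ofReal (X ω) ∂μ ≠ ⊤ := by
  refine ne_top_of_le_ne_top hY.lintegral_lt_top.ne ?_
  exact lintegral_mono fun ω => ENNReal.ofReal_le_ofReal (h ω)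

theorem expect_eq_integral (hX : Integrable X μ) : expect μ X = ((∫ ω, X ω ∂μ : ℝ) : EReal) := by
  have h1 : ∫⁻ ω, ENNReal.ofReal (X ω) ∂μ ≠ ⊤ := hX.lintegral_lt_top.ne
  have h2 : ∫⁻ ω, ENNReal.ofReal (-X ω) ∂μ ≠ ⊤ := hX.neg.lintegral_lt_top.ne
  rw [expect, integral_eq_lintegral_pos_part_sub_lintegral_neg_part hX, EReal.coe_sub,
    ← EReal.coe_ennreal_toReal h1, ← EReal.coe_ennreal_toReal h2]

theorem integrable_of_lintegral_ne_top (hm : Measurable X)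
    (h1 : ∫⁻ ω, ENNReal.ofReal (X ω) ∂μ ≠ ⊤) (h2 : ∫⁻ ω, ENNReal.ofReal (-X ω) ∂μ ≠ ⊤) :
    Integrable X μ := by
  refine ⟨hm.aestronglyMeasurable, ?_⟩
  have hn : ∀ ω, ‖X ω‖ₑ ≤ ENNReal.ofReal (X ω) + ENNReal.ofReal (-X ω) := by
    intro ω
    rw [Real.enorm_eq_ofReal_abs]
    rcases le_total 0 (X ω) with h | h
    · rw [abs_of_nonneg h]; exact le_self_add
    · rw [abs_of_nonpos h]; exact le_add_self
  refine lt_of_le_of_lt (lintegral_mono hn) ?_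
  rw [lintegral_add_left (by fun_prop)]
  exact ENNReal.add_lt_top.2 ⟨h1.lt_top, h2.lt_top⟩

theorem integrable_of_expect_ne_bot (hm : Measurable X)
    (h1 : ∫⁻ ω, ENNReal.ofReal (X ω) ∂μ ≠ ⊤) (h : expect μ X ≠ ⊥) : Integrable X μ := by
  refine integrable_of_lintegral_ne_top hm h1 fun h2 => h ?_
  rw [expect, h2, ← EReal.coe_ennreal_toReal h1]
  rfl

/-- The cross-added identity makes sense without integrability. With finite positive parts it forces
the negative parts to be infinite together; if both are finite it can be rearranged. -/
theorem expect_congr_of_lintegral (hX : ∫⁻ ω, ENNReal.ofReal (X ω) ∂μ ≠ ⊤)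
    (hY : ∫⁻ ω, ENNReal.ofReal (Y ω) ∂μ ≠ ⊤)
    (h : ∫⁻ ω, ENNReal.ofReal (X ω) ∂μ + ∫⁻ ω, ENNReal.ofReal (-Y ω) ∂μ
      = ∫⁻ ω, ENNReal.ofReal (Y ω) ∂μ + ∫⁻ ω, ENNReal.ofReal (-X ω) ∂μ) :
    expect μ X = expect μ Y := by
  unfold expect
  generalize ∫⁻ ω, ENNReal.ofReal (X ω) ∂μ = a at *
  generalize ∫⁻ ω, ENNReal.ofReal (-X ω) ∂μ = b at *
  generalize ∫⁻ ω, ENNReal.ofReal (Y ω) ∂μ = c at *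
  generalize ∫⁻ ω, ENNReal.ofReal (-Y ω) ∂μ = d at *
  lift a to NNReal using hX
  lift c to NNReal using hY
  by_cases hb : b = ⊤
  · have hd : d = ⊤ := by
      subst hb
      by_contra hd
      rw [add_top] at h
      exact ENNReal.add_ne_top.2 ⟨ENNReal.coe_ne_top, hd⟩ h
    subst hb hd
    rfl
  · have hd : d ≠ ⊤ := by
      rintro rfl
      rw [add_top] at h
      exact ENNReal.add_ne_top.2 ⟨ENNReal.coe_ne_top, hb⟩ h.symm
    lift b to NNReal using hb
    lift d to NNReal using hd
    have h' : (a : ℝ) + d = c + b := by exact_mod_cast h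
    have : ((a : ℝ) - b : ℝ) = c - d := by linarith
    simp only [EReal.coe_nnreal_eq_coe_real]
    exact_mod_cast this

end Expect

/-! ## Resampling one coordinate -/

section Resample

/-- A box pulls back to the same box with side `i` freed, times side `i`, so both measures agree on
boxes. Resampling a coordinate is how independence of own value or own seed enters all later
integrals. -/
theorem map_update_pi {ι : Type*} [Fintype ι] [DecidableEq ι] {α : ι → Type*}
    [∀ i, MeasurableSpace (α i)] (μ : ∀ i, Measure (α i)) [∀ i, IsProbabilityMeasure (μ i)]
    (i : ι) :
    ((Measure.pi μ).prod (μ i)).map (fun p => Function.update p.1 i p.2) = Measure.pi μ := by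
  have hm : Measurable fun p : (∀ i, α i) × α i => Function.update p.1 i p.2 :=
    measurable_pi_iff.2 fun j => by
      by_cases h : j = i
      · subst h; simpa using measurable_snd
      · simp only [Function.update_of_ne h]; fun_prop
  symm
  refine Measure.pi_eq fun s hs => ?_
  rw [Measure.map_apply hm (MeasurableSet.univ_pi hs)]
  have : (fun p : (∀ i, α i) × α i => Function.update p.1 i p.2) ⁻¹' Set.univ.pi s
      = (Set.univ.pi (Function.update s i Set.univ)) ×ˢ s i := by
    ext p
    simp only [Set.mem_preimage, Set.mem_pi, Set.mem_univ, true_implies, Set.mem_prod]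
    constructor
    · intro h
      refine ⟨fun j => ?_, by simpa using h i⟩
      by_cases hj : j = i
      · subst hj; simp
      · have := h j
        rwa [Function.update_of_ne hj] at this ⊢
    · rintro ⟨h, hi⟩ j
      by_cases hj : j = i
      · subst hj; simpa using hi
      · have := h j
        rwa [Function.update_of_ne hj] at this ⊢
  rw [this, Measure.prod_prod, Measure.pi_pi, ← Finset.prod_erase_mul _ _ (Finset.mem_univ i),
    ← Finset.prod_erase_mul _ _ (Finset.mem_univ i)]
  simp only [Function.update_self, measure_univ, mul_one]
  congr 1
  refine Finset.prod_congr rfl fun j hj => ?_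
  rw [Function.update_of_ne (Finset.ne_of_mem_erase hj)]

theorem measurable_update_prod {ι : Type*} [DecidableEq ι] {α : ι → Type*}
    [∀ i, MeasurableSpace (α i)] (i : ι) :
    Measurable fun p : (∀ i, α i) × α i => Function.update p.1 i p.2 :=
  measurable_pi_iff.2 fun j => by
    by_cases h : j = i
    · subst h; simpa using measurable_snd
    · simp only [Function.update_of_ne h]; fun_prop

theorem lintegral_pi_update {ι : Type*} [Fintype ι] [DecidableEq ι] {α : ι → Type*}
    [∀ i, MeasurableSpace (α i)] (μ : ∀ i, Measure (α i)) [∀ i, IsProbabilityMeasure (μ i)]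
    (i : ι) {f : (∀ i, α i) → ENNReal} (hf : Measurable f) :
    ∫⁻ x, f x ∂Measure.pi μ = ∫⁻ x, ∫⁻ y, f (Function.update x i y) ∂μ i ∂Measure.pi μ := by
  conv_lhs => rw [← map_update_pi μ i, lintegral_map hf (measurable_update_prod i)]
  exact lintegral_prod _ (hf.comp (measurable_update_prod i)).aemeasurable

variable {n : ℕ} {Θ : Fin n → Type u} [∀ i, MeasurableSpace (Θ i)]
variable {S : Type*} [MeasurableSpace S]

instance (E : Environment n Θ) : IsMarkovKernel E.valueKernel :=
  ⟨fun θ => by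
    change IsProbabilityMeasure (Measure.pi fun i => E.F i (θ i))
    infer_instance⟩

instance (E : Environment n Θ) : IsProbabilityMeasure E.law := by
  unfold Environment.law; infer_instance

instance (E : Environment n Θ) : IsProbabilityMeasure E.auctionLaw := by
  unfold Environment.auctionLaw; infer_instance

/-- Replace the value of bidder `i`. -/
def setValue (i : Fin n) (ω : ((∀ i, Θ i) × (Fin n → ℝ)) × S) (y : ℝ) :
    ((∀ i, Θ i) × (Fin n → ℝ)) × S :=
  ((ω.1.1, Function.update ω.1.2 i y), ω.2)

/-- The value kernel of bidder `i` as a kernel from the sample space. -/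
def Environment.valueAt (E : Environment n Θ) (S : Type*) [MeasurableSpace S] (i : Fin n) :
    Kernel (((∀ i, Θ i) × (Fin n → ℝ)) × S) ℝ :=
  (E.F i).comap (fun ω => ω.1.1 i) (by fun_prop)

instance (E : Environment n Θ) (i : Fin n) : IsMarkovKernel (E.valueAt S i) := by
  unfold Environment.valueAt; infer_instance

theorem measurable_setValue (i : Fin n) :
    Measurable fun p : (((∀ i, Θ i) × (Fin n → ℝ)) × S) × ℝ => setValue i p.1 p.2 := by
  unfold setValue
  refine Measurable.prodMk (Measurable.prodMk (by fun_prop) ?_) (by fun_prop)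
  exact (measurable_update_prod (α := fun _ : Fin n => ℝ) i).comp
    (by fun_prop : Measurable fun p : (((∀ i, Θ i) × (Fin n → ℝ)) × S) × ℝ => (p.1.1.2, p.2))

/-- The resampling takes place conditionally on the type profile, where the values form a product
measure; correlation between types therefore plays no role. -/
theorem lintegral_setValue (E : Environment n Θ) (ν : Measure S) [IsProbabilityMeasure ν]
    (i : Fin n) {f : ((∀ i, Θ i) × (Fin n → ℝ)) × S → ENNReal} (hf : Measurable f) :
    ∫⁻ ω, f ω ∂(E.law.prod ν)
      = ∫⁻ ω, ∫⁻ y, f (setValue i ω y) ∂(E.F i (ω.1.1 i)) ∂(E.law.prod ν) := by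
  have hg : Measurable fun ω : ((∀ i, Θ i) × (Fin n → ℝ)) × S =>
      ∫⁻ y, f (setValue i ω y) ∂(E.F i (ω.1.1 i)) :=
    Measurable.lintegral_kernel_prod_right' (κ := E.valueAt S i)
      (hf.comp (measurable_setValue i))
  rw [lintegral_prod_symm' _ hf, lintegral_prod_symm' _ hg]
  refine lintegral_congr fun s => ?_
  rw [Environment.law, Measure.lintegral_compProd (by fun_prop),
    Measure.lintegral_compProd
      (f := fun p : (∀ i, Θ i) × (Fin n → ℝ) => ∫⁻ y, f (setValue i (p, s) y) ∂(E.F i (p.1 i)))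
      (hg.comp measurable_prodMk_right)]
  refine lintegral_congr fun θ => ?_
  exact lintegral_pi_update (fun i => E.F i (θ i)) i (f := fun v => f ((θ, v), s))
    (hf.comp (by fun_prop))

/-- Replace the seed of bidder `i`. -/
def setSeed (i : Fin n) (ω : ((∀ i, Θ i) × (Fin n → ℝ)) × (Fin n → unitInterval))
    (r : unitInterval) : ((∀ i, Θ i) × (Fin n → ℝ)) × (Fin n → unitInterval) :=
  (ω.1, Function.update ω.2 i r)

theorem measurable_setSeed (i : Fin n) :
    Measurable fun p : (((∀ i, Θ i) × (Fin n → ℝ)) × (Fin n → unitInterval)) × unitInterval =>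
      setSeed i p.1 p.2 := by
  unfold setSeed
  refine Measurable.prodMk (by fun_prop) ?_
  exact (measurable_update_prod (α := fun _ : Fin n => unitInterval) i).comp
    (by fun_prop : Measurable fun p : (((∀ i, Θ i) × (Fin n → ℝ)) × (Fin n → unitInterval)) ×
      unitInterval => (p.1.2, p.2))

theorem lintegral_setSeed (E : Environment n Θ) (i : Fin n)
    {f : ((∀ i, Θ i) × (Fin n → ℝ)) × (Fin n → unitInterval) → ENNReal} (hf : Measurable f) :
    ∫⁻ ω, f ω ∂E.auctionLaw = ∫⁻ ω, ∫⁻ r, f (setSeed i ω r) ∂volume ∂E.auctionLaw := by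
  have hg : Measurable fun ω : ((∀ i, Θ i) × (Fin n → ℝ)) × (Fin n → unitInterval) =>
      ∫⁻ r, f (setSeed i ω r) :=
    Measurable.lintegral_prod_right' (hf.comp (measurable_setSeed i))
  rw [Environment.auctionLaw, lintegral_prod _ hf.aemeasurable, lintegral_prod _ hg.aemeasurable]
  refine lintegral_congr fun p => ?_
  exact lintegral_pi_update (fun _ : Fin n => (volume : Measure unitInterval)) i
    (f := fun r => f (p, r)) (hf.comp (by fun_prop))

end Resample

/-! ## The covered call value as a real number -/

section CallValue

variable {n : ℕ} {Θ : Fin n → Type u} [∀ i, MeasurableSpace (Θ i)]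
variable {S : Type*} [MeasurableSpace S]

theorem strikePrice_cases (E : Environment n Θ) (i : Fin n) (t : Θ i) :
    (E.cost i t = 0 ∧ strikePrice (E.F i t) (E.cost i t) = ⊤) ∨
      ∃ x : ℝ, strikePrice (E.F i t) (E.cost i t) = x ∧
        ∫ v, max (v - x) 0 ∂(E.F i t) = E.cost i t := by
  rcases (E.cost_nonneg i t).eq_or_lt with h | h
  · left
    rw [← h]
    exact ⟨rfl, strikePrice_zero _⟩
  · right
    obtain ⟨x, hx, -⟩ := existsUnique_strikePrice (E.integrable_type i t) h
    exact ⟨x, strikePrice_eq_of_solution (E.integrable_type i t) h hx, hx⟩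

theorem Environment.measurable_strikePrice (E : Environment n Θ) (i : Fin n) :
    Measurable fun t : Θ i => strikePrice (E.F i t) (E.cost i t) := by
  simp only [fun t => strikePrice_eq_iSup_rat (E.integrable_type i t) (E.cost i t)]
  refine Measurable.iSup fun q => ?_
  have hg : Measurable fun t : Θ i => ∫ v, max (v - (q : ℝ)) 0 ∂(E.F i t) :=
    (StronglyMeasurable.integral_kernel (κ := E.F i)
      (f := fun v : ℝ => max (v - (q : ℝ)) 0)
      (Measurable.stronglyMeasurable (by fun_prop))).measurable
  have hset := measurableSet_le (E.measurable_cost i) hg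
  classical
  have hite : Measurable fun t : Θ i =>
      if E.cost i t ≤ ∫ v, max (v - (q : ℝ)) 0 ∂(E.F i t) then (((q : ℝ)) : EReal) else ⊥ :=
    Measurable.ite hset measurable_const measurable_const
  convert hite using 2 with t
  split_ifs with h <;> simp [h]

/-- The covered call value as a real number. -/
def Environment.callValue (E : Environment n Θ) (i : Fin n) (t : Θ i) (v : ℝ) : ℝ :=
  (E.kappa i t v).toReal

theorem callValue_of_top (E : Environment n Θ) {i : Fin n} {t : Θ i}
    (h : strikePrice (E.F i t) (E.cost i t) = ⊤) (v : ℝ) : E.callValue i t v = v := by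
  simp [Environment.callValue, Environment.kappa, coveredCall, h]

theorem callValue_of_coe (E : Environment n Θ) {i : Fin n} {t : Θ i} {x : ℝ}
    (h : strikePrice (E.F i t) (E.cost i t) = x) (v : ℝ) : E.callValue i t v = min x v := by
  rw [Environment.callValue, Environment.kappa, coveredCall, h]
  rcases le_total x v with hv | hv
  · rw [min_eq_left hv, min_eq_left (EReal.coe_le_coe_iff.2 hv), EReal.toReal_coe]
  · rw [min_eq_right hv, min_eq_right (EReal.coe_le_coe_iff.2 hv), EReal.toReal_coe]

theorem callValue_le (E : Environment n Θ) (i : Fin n) (t : Θ i) (v : ℝ) :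
    E.callValue i t v ≤ v := by
  rcases strikePrice_cases E i t with ⟨-, h⟩ | ⟨x, h, -⟩
  · rw [callValue_of_top E h]
  · rw [callValue_of_coe E h]; exact min_le_right _ _

theorem measurable_callValue (E : Environment n Θ) (i : Fin n) :
    Measurable fun x : Θ i × ℝ => E.callValue i x.1 x.2 :=
  measurable_ereal_toReal.comp (E.measurable_kappa i)

attribute [irreducible] Environment.callValue

theorem measurable_type_at (i : Fin n) :
    Measurable fun ω : ((∀ i, Θ i) × (Fin n → ℝ)) × S => ω.1.1 i :=
  (measurable_pi_apply i).comp (measurable_fst.comp measurable_fst)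

theorem measurable_value_at (i : Fin n) :
    Measurable fun ω : ((∀ i, Θ i) × (Fin n → ℝ)) × S => ω.1.2 i :=
  (measurable_pi_apply i).comp (measurable_snd.comp measurable_fst)

theorem measurable_cost_at (E : Environment n Θ) (i : Fin n) :
    Measurable fun ω : ((∀ i, Θ i) × (Fin n → ℝ)) × S => E.cost i (ω.1.1 i) :=
  (E.measurable_cost i).comp (measurable_type_at i)

theorem measurable_callValue_at (E : Environment n Θ) (i : Fin n) :
    Measurable fun ω : ((∀ i, Θ i) × (Fin n → ℝ)) × S =>
      E.callValue i (ω.1.1 i) (ω.1.2 i) :=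
  (measurable_callValue E i).comp ((measurable_type_at i).prodMk (measurable_value_at i))

/-- For a finite strike price `x`, `v - min x v = (v - x)⁺`, whose mean is the cost by the choice of
`x`; with infinite strike price both sides vanish. -/
theorem lintegral_sub_callValue (E : Environment n Θ) (i : Fin n) (t : Θ i) :
    ∫⁻ v, ENNReal.ofReal (v - E.callValue i t v) ∂(E.F i t) = ENNReal.ofReal (E.cost i t) := by
  rcases strikePrice_cases E i t with ⟨h0, h⟩ | ⟨x, h, hx⟩
  · simp [callValue_of_top E h, h0]
  · rw [← hx, ofReal_integral_eq_lintegral_ofReal (integrable_call (E.integrable_type i t) x)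
      (Filter.Eventually.of_forall fun v => le_max_right _ _)]
    refine lintegral_congr fun v => ?_
    rw [callValue_of_coe E h]
    congr 1
    rcases le_total x v with hv | hv
    · rw [min_eq_left hv, max_eq_left (by linarith)]
    · rw [min_eq_right hv, max_eq_right (by linarith), sub_self]

theorem integrable_posPart_value (E : Environment n Θ) (ν : Measure S) [IsProbabilityMeasure ν]
    (i : Fin n) : Integrable (fun ω => max (ω.1.2 i) 0) (E.law.prod ν) := by
  have hm : Measurable fun ω : ((∀ i, Θ i) × (Fin n → ℝ)) × S => max (ω.1.2 i) 0 := by fun_prop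
  refine ⟨hm.aestronglyMeasurable, ?_⟩
  have h := (E.integrable_exAnte i).2
  rw [HasFiniteIntegral] at h ⊢
  rw [lintegral_setValue E ν i (by fun_prop)]
  rw [Measure.lintegral_compProd (by fun_prop)] at h
  simp only [Kernel.comap_apply] at h
  have hg : Measurable fun θ : ∀ i, Θ i => ∫⁻ y, ‖max y 0‖ₑ ∂(E.F i (θ i)) :=
    (Measurable.lintegral_kernel (κ := E.F i) (f := fun y : ℝ => ‖max y 0‖ₑ)
      (by fun_prop)).comp (measurable_pi_apply i)
  have key : ∫⁻ ω, ∫⁻ y, ‖max ((setValue i ω y).1.2 i) 0‖ₑ ∂(E.F i (ω.1.1 i)) ∂(E.law.prod ν)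
      = ∫⁻ θ, ∫⁻ y, ‖max y 0‖ₑ ∂(E.F i (θ i)) ∂E.prior := by
    simp only [setValue, Function.update_self]
    rw [lintegral_prod_symm' (fun ω : ((∀ i, Θ i) × (Fin n → ℝ)) × S =>
      ∫⁻ y, ‖max y 0‖ₑ ∂(E.F i (ω.1.1 i))) (hg.comp (measurable_fst.comp measurable_fst))]
    simp only [Environment.law]
    rw [Measure.lintegral_compProd (f := fun p : (∀ i, Θ i) × (Fin n → ℝ) =>
      ∫⁻ y, ‖max y 0‖ₑ ∂(E.F i (p.1 i))) (hg.comp measurable_fst)]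
    simp
  rw [key]
  exact h

/-- This is `x⁺ - x⁻ = x` for `x = z - A` and `x = z - B`, with subtractions removed. It will be
integrated with `A = I c` and `B = I (v - κ)`, which have the same conditional mean. -/
theorem ofReal_sub_add_ofReal_sub {z A B : ℝ} (hA : 0 ≤ A) (hB : 0 ≤ B) :
    ENNReal.ofReal A + (ENNReal.ofReal (z - A) + ENNReal.ofReal (-(z - B)))
      = ENNReal.ofReal B + (ENNReal.ofReal (z - B) + ENNReal.ofReal (-(z - A))) := by
  have hp : ∀ x : ℝ, ENNReal.ofReal x = ENNReal.ofReal (max x 0) := by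
    intro x
    rcases le_total x 0 with h | h
    · rw [max_eq_right h, ENNReal.ofReal_of_nonpos h, ENNReal.ofReal_zero]
    · rw [max_eq_left h]
  have e : ∀ x : ℝ, max x 0 = x + max (-x) 0 := fun x => by
    rcases le_total x 0 with h | h
    · rw [max_eq_right h, max_eq_left (by linarith)]; ring
    · rw [max_eq_left h, max_eq_right (by linarith)]; ring
  have h0 : ∀ x : ℝ, 0 ≤ max x 0 := fun x => le_max_right _ _
  rw [hp (z - A), hp (-(z - B)), hp (z - B), hp (-(z - A)),
    ← ENNReal.ofReal_add (h0 _) (h0 _), ← ENNReal.ofReal_add (h0 _) (h0 _),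
    ← ENNReal.ofReal_add hA (add_nonneg (h0 _) (h0 _)),
    ← ENNReal.ofReal_add hB (add_nonneg (h0 _) (h0 _))]
  congr 1
  rw [e (z - A), e (z - B)]
  ring

/-- If the inspection decision does not depend on the value, the inspection cost may be replaced by
the loss `v - κ` without changing the expectation. -/
theorem expect_cost_eq (E : Environment n Θ) (ν : Measure S) [IsProbabilityMeasure ν] (i : Fin n)
    {Z I : ((∀ i, Θ i) × (Fin n → ℝ)) × S → ℝ} (hZ : Measurable Z) (hI : Measurable I)
    (hI0 : ∀ ω, 0 ≤ I ω) (hupd : ∀ ω y, I (setValue i ω y) = I ω)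
    (h1 : ∫⁻ ω, ENNReal.ofReal (Z ω - I ω * E.cost i (ω.1.1 i)) ∂(E.law.prod ν) ≠ ⊤)
    (h2 : ∫⁻ ω, ENNReal.ofReal (Z ω - I ω * (ω.1.2 i - E.callValue i (ω.1.1 i) (ω.1.2 i)))
      ∂(E.law.prod ν) ≠ ⊤) :
    expect (E.law.prod ν) (fun ω => Z ω - I ω * E.cost i (ω.1.1 i))
      = expect (E.law.prod ν)
        (fun ω => Z ω - I ω * (ω.1.2 i - E.callValue i (ω.1.1 i) (ω.1.2 i))) := by
  have hc := measurable_cost_at (S := S) E i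
  have hk := measurable_callValue_at (S := S) E i
  have hX : Measurable fun ω => Z ω - I ω * E.cost i (ω.1.1 i) := hZ.sub (hI.mul hc)
  have hv := measurable_value_at (Θ := Θ) (S := S) i
  have hY : Measurable fun ω =>
      Z ω - I ω * (ω.1.2 i - E.callValue i (ω.1.1 i) (ω.1.2 i)) :=
    hZ.sub (hI.mul (hv.sub hk))
  have hXY : Measurable fun ω => ENNReal.ofReal (Z ω - I ω * E.cost i (ω.1.1 i))
      + ENNReal.ofReal (-(Z ω - I ω * (ω.1.2 i - E.callValue i (ω.1.1 i) (ω.1.2 i)))) :=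
    hX.ennreal_ofReal.add hY.neg.ennreal_ofReal
  have hYX : Measurable fun ω =>
      ENNReal.ofReal (Z ω - I ω * (ω.1.2 i - E.callValue i (ω.1.1 i) (ω.1.2 i)))
      + ENNReal.ofReal (-(Z ω - I ω * E.cost i (ω.1.1 i))) :=
    hY.ennreal_ofReal.add hX.neg.ennreal_ofReal
  refine expect_congr_of_lintegral h1 h2 ?_
  rw [← lintegral_add_left hX.ennreal_ofReal, ← lintegral_add_left hY.ennreal_ofReal,
    lintegral_setValue E ν i hXY, lintegral_setValue E ν i hYX]
  refine lintegral_congr fun ω => ?_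
  have hfin : ENNReal.ofReal (I ω * E.cost i (ω.1.1 i)) ≠ ⊤ := ENNReal.ofReal_ne_top
  have e1 : ∫⁻ _, ENNReal.ofReal (I ω * E.cost i (ω.1.1 i)) ∂(E.F i (ω.1.1 i))
      = ENNReal.ofReal (I ω * E.cost i (ω.1.1 i)) := by simp
  have e2 : ∫⁻ y, ENNReal.ofReal (I ω * (y - E.callValue i (ω.1.1 i) y)) ∂(E.F i (ω.1.1 i))
      = ENNReal.ofReal (I ω * E.cost i (ω.1.1 i)) := by
    simp only [ENNReal.ofReal_mul (hI0 ω)]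
    rw [lintegral_const_mul' _ _ ENNReal.ofReal_ne_top, lintegral_sub_callValue]
  have hmk : Measurable fun y => E.callValue i (ω.1.1 i) y :=
    (measurable_callValue E i).comp measurable_prodMk_left
  have hm2 : Measurable fun y => ENNReal.ofReal (I ω * (y - E.callValue i (ω.1.1 i) y)) :=
    (measurable_const.mul (measurable_id.sub hmk)).ennreal_ofReal
  -- Add the finite number `I c` to both sides, written on the left as the integral of `I c` and on
  -- the right as that of `I (v - κ)`. The claim then holds pointwise, although `Z` may depend on
  -- the resampled value.
  refine (ENNReal.add_right_inj hfin).1 ?_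
  refine Eq.trans (congrArg (· + _) e1.symm) (Eq.trans ?_ (congrArg (· + _) e2))
  refine (lintegral_add_left measurable_const _).symm.trans
    (Eq.trans ?_ (lintegral_add_left hm2 _))
  refine lintegral_congr fun y => ?_
  have ev : (setValue i ω y).1.2 i = y := by simp [setValue]
  have et : (setValue i ω y).1.1 i = ω.1.1 i := rfl
  rw [ev, et, hupd]
  exact ofReal_sub_add_ofReal_sub (mul_nonneg (hI0 ω) (E.cost_nonneg _ _))
    (mul_nonneg (hI0 ω) (sub_nonneg.2 (callValue_le E i _ y)))

end CallValue

/-! ## The upper bound on the welfare of a procedure -/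

section FirstBest

variable {n : ℕ} {Θ : Fin n → Type u} [∀ i, MeasurableSpace (Θ i)]

/-- The positive part of the highest covered call value. -/
def Environment.bestCall (E : Environment n Θ) (p : (∀ i, Θ i) × (Fin n → ℝ)) : ℝ :=
  ((Finset.univ.sup fun i => (E.callValue i (p.1 i) (p.2 i)).toNNReal : NNReal) : ℝ)

theorem bestCall_nonneg (E : Environment n Θ) (p) : 0 ≤ E.bestCall p := NNReal.coe_nonneg _

theorem callValue_le_bestCall (E : Environment n Θ) (p) (i : Fin n) :
    E.callValue i (p.1 i) (p.2 i) ≤ E.bestCall p :=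
  (Real.le_coe_toNNReal _).trans (NNReal.coe_le_coe.2
    (Finset.le_sup (f := fun i => (E.callValue i (p.1 i) (p.2 i)).toNNReal) (Finset.mem_univ i)))

theorem bestCall_eq_zero_or (E : Environment n Θ) (p) :
    E.bestCall p = 0 ∨ ∃ i, 0 < E.callValue i (p.1 i) (p.2 i) ∧
      E.bestCall p = E.callValue i (p.1 i) (p.2 i) := by
  rcases (Finset.univ : Finset (Fin n)).eq_empty_or_nonempty with h | h
  · left; simp [Environment.bestCall, h]
  · obtain ⟨i, -, hi⟩ := Finset.exists_mem_eq_sup _ h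
      (fun i => (E.callValue i (p.1 i) (p.2 i)).toNNReal)
    rcases le_or_gt (E.callValue i (p.1 i) (p.2 i)) 0 with h0 | h0
    · left; rw [Environment.bestCall, hi, Real.toNNReal_of_nonpos h0]; rfl
    · right; exact ⟨i, h0, by rw [Environment.bestCall, hi, Real.coe_toNNReal _ h0.le]⟩

theorem measurable_bestCall (E : Environment n Θ) : Measurable E.bestCall := by
  unfold Environment.bestCall
  refine measurable_coe_nnreal_real.comp ?_
  have : (fun p : (∀ i, Θ i) × (Fin n → ℝ) =>
      Finset.univ.sup fun i => (E.callValue i (p.1 i) (p.2 i)).toNNReal)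
      = Finset.univ.sup fun i => fun p : (∀ i, Θ i) × (Fin n → ℝ) =>
        (E.callValue i (p.1 i) (p.2 i)).toNNReal := by
    ext p; simp [Finset.sup_apply]
  rw [this]
  refine Finset.sup_induction measurable_const (fun f hf g hg => hf.sup hg) fun i _ => ?_
  exact ((measurable_callValue E i).comp (((measurable_pi_apply i).comp measurable_fst).prodMk
    ((measurable_pi_apply i).comp measurable_snd))).real_toNNReal

theorem bestCall_le_sum (E : Environment n Θ) (p) : E.bestCall p ≤ ∑ i, max (p.2 i) 0 := by
  have h0 : ∀ i ∈ (Finset.univ : Finset (Fin n)), 0 ≤ max (p.2 i) 0 := fun i _ => le_max_right _ _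
  rcases bestCall_eq_zero_or E p with h | ⟨i, -, h⟩
  · rw [h]; exact Finset.sum_nonneg h0
  · rw [h]
    exact (callValue_le E i _ _).trans ((le_max_left _ _).trans
      (Finset.single_le_sum h0 (Finset.mem_univ i)))

variable {S : Type*} [MeasurableSpace S]

theorem integrable_sum_posPart (E : Environment n Θ) (ν : Measure S) [IsProbabilityMeasure ν]
    (s : Finset (Fin n)) : Integrable (fun ω => ∑ i ∈ s, max (ω.1.2 i) 0) (E.law.prod ν) :=
  integrable_finsetSum _ fun i _ => integrable_posPart_value E ν i

theorem integrable_bestCall (E : Environment n Θ) (ν : Measure S) [IsProbabilityMeasure ν] :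
    Integrable (fun ω => E.bestCall ω.1) (E.law.prod ν) := by
  refine (integrable_sum_posPart E ν Finset.univ).mono'
    ((measurable_bestCall E).comp measurable_fst).aestronglyMeasurable ?_
  filter_upwards with ω
  rw [Real.norm_eq_abs, abs_of_nonneg (bestCall_nonneg E _)]
  exact bestCall_le_sum E ω.1

theorem integral_bestCall (E : Environment n Θ) (ν : Measure S) [IsProbabilityMeasure ν] :
    ∫ ω, E.bestCall ω.1 ∂(E.law.prod ν) = ∫ p, E.bestCall p ∂E.law := by
  rw [integral_fun_fst]; simp

/-- If a sum of functions with integrable upper bounds is integrable, so are the summands. -/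
theorem integrable_of_sum {Ω ι : Type*} [MeasurableSpace Ω] {μ : Measure Ω} [Fintype ι]
    [DecidableEq ι] {X g : ι → Ω → ℝ} (hX : ∀ i, Measurable (X i)) (hg : ∀ i, Integrable (g i) μ)
    (h : ∀ i ω, X i ω ≤ g i ω) (hs : Integrable (fun ω => ∑ i, X i ω) μ) (i : ι) :
    Integrable (X i) μ := by
  -- This function is an integrable lower bound for `X i`, since the other summands are at most
  -- their `g j`.
  have hlow : Integrable (fun ω => ∑ j, X j ω - ∑ j ∈ Finset.univ.erase i, g j ω) μ :=
    hs.sub (integrable_finsetSum _ fun j _ => hg j)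
  refine (hlow.norm.add (hg i).norm).mono' (hX i).aestronglyMeasurable ?_
  filter_upwards with ω
  have e := Finset.add_sum_erase Finset.univ (fun j => X j ω) (Finset.mem_univ i)
  have l : ∑ j ∈ Finset.univ.erase i, X j ω ≤ ∑ j ∈ Finset.univ.erase i, g j ω :=
    Finset.sum_le_sum fun j _ => h j ω
  simp only [Pi.add_apply, Real.norm_eq_abs]
  have h1 := neg_abs_le (∑ j, X j ω - ∑ j ∈ Finset.univ.erase i, g j ω)
  have h2 := le_abs_self (g i ω)
  have h3 := abs_nonneg (∑ j, X j ω - ∑ j ∈ Finset.univ.erase i, g j ω)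
  have h4 := abs_nonneg (g i ω)
  have h5 := h i ω
  rw [abs_le]
  constructor <;> linarith

theorem observed_update {s : Finset (Fin n)} {i : Fin n} (h : i ∉ s) (v : Fin n → ℝ) (y : ℝ) :
    observed s (Function.update v i y) = observed s v := by
  funext j
  unfold observed
  split_ifs with hj
  · rw [Function.update_of_ne (ne_of_mem_of_not_mem hj h)]
  · rfl

/-! ### Non-anticipation and measurability of procedures -/

namespace Procedure

variable (π : Procedure n Θ)

/-- As long as `i` has not been inspected, the observed values do not involve `v i`, so the run of
the procedure is unchanged. -/
theorem inspectedAfter_update (r : unitInterval) (θ : ∀ i, Θ i) (v : Fin n → ℝ) (i : Fin n) (y : ℝ)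
    (k : ℕ) (h : i ∉ π.inspectedAfter r θ v k) :
    π.inspectedAfter r θ (Function.update v i y) k = π.inspectedAfter r θ v k := by
  induction k with
  | zero => rfl
  | succ k ih =>
    have hk : i ∉ π.inspectedAfter r θ v k := by
      intro hk
      apply h
      simp only [inspectedAfter]
      split
      · exact hk
      · exact Finset.mem_insert_of_mem hk
    simp only [inspectedAfter, ih hk, observed_update hk]

/-- If `i` does not pay, her value is never observed and changing it alters neither the inspections
nor the award. This is the non-anticipation needed for `expect_cost_eq`. -/
theorem mem_payers_update (r : unitInterval) (θ : ∀ i, Θ i) (v : Fin n → ℝ) (i : Fin n) (y : ℝ) :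
    i ∈ π.payers r θ (Function.update v i y) ↔ i ∈ π.payers r θ v := by
  have main : ∀ (v : Fin n → ℝ) (y : ℝ), i ∉ π.payers r θ v →
      i ∉ π.payers r θ (Function.update v i y) := by
    intro v y h
    simp only [payers, Finset.mem_union, not_or] at h ⊢
    have e := π.inspectedAfter_update r θ v i y n h.1
    rw [e]
    refine ⟨h.1, ?_⟩
    rw [winner, e, observed_update h.1]
    exact h.2
  constructor
  · intro h; by_contra h'; exact main v y h' h
  -- The converse is the same implication for the updated profile, followed by restoring `v i`.
  · intro h; by_contra h'
    have := main _ (v i) h'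
    simp only [Function.update_idem, Function.update_eq_self] at this
    exact this h

theorem measurable_observed (s : Finset (Fin n)) : Measurable (observed s) := by
  refine measurable_pi_iff.2 fun j => ?_
  unfold observed
  by_cases h : j ∈ s
  · simpa [h] using measurable_pi_apply j
  · simp [h]

theorem measurable_triple_observed (s : Finset (Fin n)) :
    Measurable fun ω : ((∀ i, Θ i) × (Fin n → ℝ)) × unitInterval =>
      (ω.2, ω.1.1, observed s ω.1.2) :=
  measurable_snd.prodMk ((measurable_fst.comp measurable_fst).prodMk
    ((measurable_observed s).comp (measurable_snd.comp measurable_fst)))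

theorem measurableSet_inspectedAfter (k : ℕ) (s : Finset (Fin n)) :
    MeasurableSet {ω : ((∀ i, Θ i) × (Fin n → ℝ)) × unitInterval |
      π.inspectedAfter ω.2 ω.1.1 ω.1.2 k = s} := by
  induction k generalizing s with
  | zero => simp [inspectedAfter]
  | succ k ih =>
    have : {ω : ((∀ i, Θ i) × (Fin n → ℝ)) × unitInterval |
        π.inspectedAfter ω.2 ω.1.1 ω.1.2 (k + 1) = s}
        = ⋃ (t : Finset (Fin n)) (o : Option (Fin n)),
          ({ω | π.inspectedAfter ω.2 ω.1.1 ω.1.2 k = t} ∩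
            ({ω | π.next t ω.2 ω.1.1 (observed t ω.1.2) = o} ∩
              {_ω | (match o with | none => t | some j => insert j t) = s})) := by
      ext ω
      simp only [Set.mem_iUnion, Set.mem_inter_iff, Set.mem_ofPred_eq, inspectedAfter]
      constructor
      · intro h
        exact ⟨_, _, rfl, rfl, h⟩
      · rintro ⟨t, o, rfl, rfl, h⟩
        exact h
    rw [this]
    refine MeasurableSet.iUnion fun t => MeasurableSet.iUnion fun o => (ih t).inter
      (MeasurableSet.inter ?_ (MeasurableSet.const _))
    exact (measurable_triple_observed t) (π.measurable_next t o)

theorem measurableSet_winner (o : Option (Fin n)) :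
    MeasurableSet {ω : ((∀ i, Θ i) × (Fin n → ℝ)) × unitInterval |
      π.winner ω.2 ω.1.1 ω.1.2 = o} := by
  have : {ω : ((∀ i, Θ i) × (Fin n → ℝ)) × unitInterval | π.winner ω.2 ω.1.1 ω.1.2 = o}
      = ⋃ t : Finset (Fin n), ({ω | π.inspectedAfter ω.2 ω.1.1 ω.1.2 n = t} ∩
          {ω | π.award t ω.2 ω.1.1 (observed t ω.1.2) = o}) := by
    ext ω
    simp [winner]
  rw [this]
  exact MeasurableSet.iUnion fun t => (π.measurableSet_inspectedAfter n t).inter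
    ((measurable_triple_observed t) (π.measurable_award t o))

theorem measurableSet_mem_payers (i : Fin n) :
    MeasurableSet {ω : ((∀ i, Θ i) × (Fin n → ℝ)) × unitInterval |
      i ∈ π.payers ω.2 ω.1.1 ω.1.2} := by
  have : {ω : ((∀ i, Θ i) × (Fin n → ℝ)) × unitInterval | i ∈ π.payers ω.2 ω.1.1 ω.1.2}
      = (⋃ t : {t : Finset (Fin n) // i ∈ t},
          {ω | π.inspectedAfter ω.2 ω.1.1 ω.1.2 n = t.1})
        ∪ {ω | π.winner ω.2 ω.1.1 ω.1.2 = some i} := by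
    ext ω
    simp [payers]
  rw [this]
  exact (MeasurableSet.iUnion fun t : {t : Finset (Fin n) // i ∈ t} =>
    π.measurableSet_inspectedAfter n t.1).union
    (π.measurableSet_winner _)

/-- No procedure achieves more than the expected highest covered call value. -/
theorem welfare_le (E : Environment n Θ) :
    π.welfare E ≤ ((∫ p, E.bestCall p ∂E.law : ℝ) : EReal) := by
  set P := E.law.prod (volume : Measure unitInterval) with hP
  let Z : Fin n → ((∀ i, Θ i) × (Fin n → ℝ)) × unitInterval → ℝ := fun i ω =>
    if π.winner ω.2 ω.1.1 ω.1.2 = some i then ω.1.2 i else 0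
  let I : Fin n → ((∀ i, Θ i) × (Fin n → ℝ)) × unitInterval → ℝ := fun i ω =>
    if i ∈ π.payers ω.2 ω.1.1 ω.1.2 then 1 else 0
  let X : Fin n → ((∀ i, Θ i) × (Fin n → ℝ)) × unitInterval → ℝ := fun i ω =>
    Z i ω - I i ω * E.cost i (ω.1.1 i)
  let Y : Fin n → ((∀ i, Θ i) × (Fin n → ℝ)) × unitInterval → ℝ := fun i ω =>
    Z i ω - I i ω * (ω.1.2 i - E.callValue i (ω.1.1 i) (ω.1.2 i))
  have hZ : ∀ i, Measurable (Z i) := fun i =>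
    Measurable.ite (π.measurableSet_winner _) (measurable_value_at i) measurable_const
  have hI : ∀ i, Measurable (I i) := fun i =>
    Measurable.ite (π.measurableSet_mem_payers i) measurable_const measurable_const
  have hI0 : ∀ i ω, 0 ≤ I i ω := fun i ω => by
    simp only [I]; split_ifs <;> norm_num
  have hZI : ∀ i ω, Z i ω = 0 ∨ (Z i ω = ω.1.2 i ∧ I i ω = 1) := fun i ω => by
    by_cases h : π.winner ω.2 ω.1.1 ω.1.2 = some i
    · right; simp [Z, I, payers, h]
    · left; simp [Z, h]
  have hX : ∀ i, Measurable (X i) := fun i =>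
    (hZ i).sub ((hI i).mul (measurable_cost_at E i))
  have hY : ∀ i, Measurable (Y i) := fun i =>
    (hZ i).sub ((hI i).mul ((measurable_value_at i).sub (measurable_callValue_at E i)))
  have hXle : ∀ i ω, X i ω ≤ max (ω.1.2 i) 0 := fun i ω => by
    have h1 := mul_nonneg (hI0 i ω) (E.cost_nonneg i (ω.1.1 i))
    rcases hZI i ω with h | ⟨h, -⟩
    · simp only [X, h]; exact le_max_of_le_right (by linarith)
    · simp only [X, h]; exact le_max_of_le_left (by linarith)
  have hYle : ∀ i ω, Y i ω ≤ max (ω.1.2 i) 0 := fun i ω => by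
    have h1 := mul_nonneg (hI0 i ω) (sub_nonneg.2 (callValue_le E i (ω.1.1 i) (ω.1.2 i)))
    rcases hZI i ω with h | ⟨h, -⟩
    · simp only [Y, h]; exact le_max_of_le_right (by linarith)
    · simp only [Y, h]; exact le_max_of_le_left (by linarith)
  have hXp : ∀ i, ∫⁻ ω, ENNReal.ofReal (X i ω) ∂P ≠ ⊤ := fun i =>
    lintegral_ofReal_ne_top_of_le (integrable_posPart_value E volume i) (hXle i)
  have hYp : ∀ i, ∫⁻ ω, ENNReal.ofReal (Y i ω) ∂P ≠ ⊤ := fun i =>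
    lintegral_ofReal_ne_top_of_le (integrable_posPart_value E volume i) (hYle i)
  have hXY : ∀ i, expect P (X i) = expect P (Y i) := fun i =>
    expect_cost_eq E volume i (hZ i) (hI i) (hI0 i) (fun ω y => by
      simp only [I, setValue, π.mem_payers_update]) (hXp i) (hYp i)
  have hWX : π.welfare E = expect P fun ω => ∑ i, X i ω := by
    unfold welfare
    congr 1
    funext ω
    refine Finset.sum_congr rfl fun i _ => ?_
    simp only [X, Z, I, ite_mul, one_mul, zero_mul]
  rw [hWX]
  -- Costs need not be integrable. Welfare `-∞` is a trivial case; otherwise the sum is integrable,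
  -- and so is each summand, being bounded above by `v⁺`.
  by_cases hb : expect P (fun ω => ∑ i, X i ω) = ⊥
  · rw [hb]; exact bot_le
  have hint : Integrable (fun ω => ∑ i, X i ω) P := by
    refine integrable_of_expect_ne_bot (Finset.measurable_fun_sum _ fun i _ => hX i) ?_ hb
    exact lintegral_ofReal_ne_top_of_le (integrable_sum_posPart E volume Finset.univ)
      fun ω => Finset.sum_le_sum fun i _ => hXle i ω
  have hXi := integrable_of_sum hX (fun i => integrable_posPart_value E volume i) hXle hint
  have hYi : ∀ i, Integrable (Y i) P := fun i => by
    refine integrable_of_expect_ne_bot (hY i) (hYp i) ?_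
    rw [← hXY i, expect_eq_integral (hXi i)]
    exact EReal.coe_ne_bot _
  have hEq : ∀ i, ∫ ω, X i ω ∂P = ∫ ω, Y i ω ∂P := fun i => by
    have := hXY i
    rw [expect_eq_integral (hXi i), expect_eq_integral (hYi i)] at this
    exact_mod_cast this
  rw [expect_eq_integral hint, integral_finsetSum _ fun i _ => hXi i,
    Finset.sum_congr rfl fun i _ => hEq i, ← integral_finsetSum _ fun i _ => hYi i,
    EReal.coe_le_coe_iff, ← integral_bestCall E (volume : Measure unitInterval)]
  refine integral_mono (integrable_finsetSum _ fun i _ => hYi i)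
    (integrable_bestCall E volume) fun ω => ?_
  -- The winner is among the payers, so her term is exactly `κ`; a loser contributes at most `0`.
  have hYk : ∀ i, Y i ω ≤ if π.winner ω.2 ω.1.1 ω.1.2 = some i then
      E.bestCall ω.1 else 0 := fun i => by
    have h1 := mul_nonneg (hI0 i ω) (sub_nonneg.2 (callValue_le E i (ω.1.1 i) (ω.1.2 i)))
    split_ifs with h
    · have hI1 : I i ω = 1 := by simp [I, payers, h]
      have hZ1 : Z i ω = ω.1.2 i := by simp [Z, h]
      simp only [Y, hI1, hZ1]
      linarith [callValue_le_bestCall E ω.1 i]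
    · have hZ0 : Z i ω = 0 := by simp [Z, h]
      simp only [Y, hZ0]
      linarith
  refine (Finset.sum_le_sum fun i _ => hYk i).trans ?_
  rcases hw : π.winner ω.2 ω.1.1 ω.1.2 with _ | j
  · simpa using bestCall_nonneg E ω.1
  · simp

end Procedure

theorem optimalWelfare_le (E : Environment n Θ) :
    optimalWelfare E ≤ ((∫ p, E.bestCall p ∂E.law : ℝ) : EReal) :=
  iSup_le fun π => π.welfare_le E

end FirstBest

/-! ## Claim prices and winning probabilities -/

section WinProb

theorem Strategy.bid_eq_bot_or {T : Type u} [MeasurableSpace T] (s : Strategy T)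
    (t : T) (v : ℝ) (r : unitInterval) : s.bid t v r = ⊥ ∨ 0 ≤ s.bid t v r := by
  unfold Strategy.bid
  split_ifs with h
  · exact Or.inr h
  · exact Or.inl rfl

theorem Strategy.bid_le_inspectAt {T : Type u} [MeasurableSpace T] (s : Strategy T)
    (t : T) (v : ℝ) (r : unitInterval) : s.bid t v r ≤ s.inspectAt t r := by
  unfold Strategy.bid
  split_ifs with h
  · exact min_le_left _ _
  · exact bot_le

theorem Strategy.bid_lt_top {T : Type u} [MeasurableSpace T] (s : Strategy T)
    (t : T) (v : ℝ) (r : unitInterval) : s.bid t v r < ⊤ := by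
  unfold Strategy.bid
  split_ifs with h
  · exact (min_le_right _ _).trans_lt (s.claimAt_lt_top t v r)
  · exact bot_lt_top

theorem Strategy.measurable_bid {T : Type u} [MeasurableSpace T] (s : Strategy T) :
    Measurable fun x : T × ℝ × unitInterval => s.bid x.1 x.2.1 x.2.2 := by
  have h : Measurable fun x : T × ℝ × unitInterval =>
      min (s.inspectAt x.1 x.2.2) (s.claimAt x.1 x.2.1 x.2.2) :=
    (s.measurable_inspectAt.comp
      (measurable_fst.prodMk (measurable_snd.comp measurable_snd))).min s.measurable_claimAt
  exact Measurable.ite (measurableSet_le measurable_const h) h measurable_const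

variable {n : ℕ}

theorem winProb_nonneg (b : Fin n → EReal) (i : Fin n) : 0 ≤ winProb b i := by
  unfold winProb
  split_ifs <;> positivity

theorem winProb_le_one (b : Fin n → EReal) (i : Fin n) : winProb b i ≤ 1 := by
  classical
  unfold winProb
  split_ifs with h
  · rw [div_le_one]
    · have : 0 < (Finset.univ.filter fun j => b j = b i).card := Finset.card_pos.2 ⟨i, by simp⟩
      exact_mod_cast this
    · have : 0 < (Finset.univ.filter fun j => b j = b i).card := Finset.card_pos.2 ⟨i, by simp⟩
      exact_mod_cast this
  · exact zero_le_one

theorem winProb_of_not {b : Fin n → EReal} {i : Fin n} (h : ¬(0 ≤ b i ∧ ∀ j, b j ≤ b i)) :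
    winProb b i = 0 := if_neg h

theorem of_winProb_ne_zero {b : Fin n → EReal} {i : Fin n} (h : winProb b i ≠ 0) :
    0 ≤ b i ∧ ∀ j, b j ≤ b i := by
  by_contra h'
  exact h (winProb_of_not h')

theorem winProb_pos {b : Fin n → EReal} {i : Fin n} (h : 0 ≤ b i ∧ ∀ j, b j ≤ b i) :
    0 < winProb b i := by
  classical
  rw [winProb, if_pos h]
  have : 0 < (Finset.univ.filter fun j => b j = b i).card := Finset.card_pos.2 ⟨i, by simp⟩
  positivity

theorem winProb_eq_one {b : Fin n → EReal} {i : Fin n} (h0 : 0 ≤ b i)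
    (h : ∀ j, j ≠ i → b j < b i) : winProb b i = 1 := by
  classical
  have h' : ∀ j, b j ≤ b i := fun j => by
    by_cases hj : j = i
    · rw [hj]
    · exact (h j hj).le
  have : (Finset.univ.filter fun j => b j = b i) = {i} := by
    ext j
    simp only [Finset.mem_filter, Finset.mem_univ, true_and, Finset.mem_singleton]
    exact ⟨fun e => by_contra fun hj => (h j hj).ne e, fun e => by rw [e]⟩
  rw [winProb, if_pos ⟨h0, h'⟩]
  simp only [Finset.card_eq_one.2 ⟨i, this⟩, Nat.cast_one, div_one]

theorem winProb_lt_one {b : Fin n → EReal} {i j : Fin n} (hij : j ≠ i) (h : b j = b i) :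
    winProb b i < 1 := by
  classical
  unfold winProb
  split_ifs with h0
  · have : 1 < (Finset.univ.filter fun j => b j = b i).card :=
      Finset.one_lt_card.2 ⟨j, by simp [h], i, by simp, hij⟩
    rw [div_lt_one (by exact_mod_cast (zero_lt_one.trans this))]
    exact_mod_cast this
  · exact zero_lt_one

/-- If somebody claims, the item is sold. -/
theorem sum_winProb {b : Fin n → EReal} {i : Fin n} (h : 0 ≤ b i ∧ ∀ j, b j ≤ b i) :
    ∑ j, winProb b j = 1 := by
  classical
  have key : ∀ j, winProb b j = if b j = b i then
      1 / ((Finset.univ.filter fun j => b j = b i).card : ℝ) else 0 := by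
    intro j
    by_cases hj : b j = b i
    · rw [if_pos hj, winProb, hj, if_pos h]
    · rw [if_neg hj]
      apply winProb_of_not
      rintro ⟨-, hj'⟩
      exact hj (le_antisymm (h.2 j) (hj' i))
  rw [Finset.sum_congr rfl fun j _ => key j, ← Finset.sum_filter, Finset.sum_const, nsmul_eq_mul]
  have : 0 < (Finset.univ.filter fun j => b j = b i).card := Finset.card_pos.2 ⟨i, by simp⟩
  field_simp

theorem winProb_eq_zero_or_exists_max (b : Fin n → EReal) :
    (∀ i, winProb b i = 0 ∧ b i < 0) ∨ ∃ i, 0 ≤ b i ∧ ∀ j, b j ≤ b i := by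
  by_cases h : ∃ i, 0 ≤ b i
  · right
    obtain ⟨i, hi⟩ := h
    obtain ⟨m, -, hm⟩ := Finset.exists_max_image Finset.univ b ⟨i, Finset.mem_univ i⟩
    exact ⟨m, hi.trans (hm i (Finset.mem_univ i)), fun j => hm j (Finset.mem_univ j)⟩
  · left
    push Not at h
    exact fun i => ⟨winProb_of_not fun h' => (h i).not_ge h'.1, h i⟩

theorem measurable_winProb (i : Fin n) : Measurable fun b : Fin n → EReal => winProb b i := by
  classical
  unfold winProb
  refine Measurable.ite ?_ ?_ measurable_const
  · refine (measurableSet_le measurable_const (measurable_pi_apply i)).inter ?_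
    have : {b : Fin n → EReal | ∀ j, b j ≤ b i} = ⋂ j, {b | b j ≤ b i} := by ext; simp
    change MeasurableSet {b : Fin n → EReal | ∀ j, b j ≤ b i}
    rw [this]
    exact MeasurableSet.iInter fun j =>
      measurableSet_le (measurable_pi_apply j) (measurable_pi_apply i)
  · have : (fun b : Fin n → EReal => 1 / ((Finset.univ.filter fun j => b j = b i).card : ℝ))
        = fun b => 1 / ∑ j, if b j = b i then (1 : ℝ) else 0 := by
      funext b
      simp
    have hm : Measurable fun b : Fin n → EReal => 1 / ∑ j, if b j = b i then (1 : ℝ) else 0 :=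
      measurable_const.div (Finset.measurable_fun_sum _ fun j _ =>
        Measurable.ite (measurableSet_eq_fun (measurable_pi_apply j) (measurable_pi_apply i))
          measurable_const measurable_const)
    rw [← this] at hm
    convert hm

end WinProb

/-! ### Claim prices and inspection events in the auction -/

section Auction

variable {n : ℕ} {Θ : Fin n → Type u} [∀ i, MeasurableSpace (Θ i)]

/-- The sample space of the auction. -/
abbrev Sample (Θ : Fin n → Type u) : Type u :=
  ((∀ i, Θ i) × (Fin n → ℝ)) × (Fin n → unitInterval)

theorem measurable_seed_at (i : Fin n) : Measurable fun ω : Sample Θ => ω.2 i :=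
  (measurable_pi_apply i).comp measurable_snd

theorem measurable_bidAt (s : ∀ i, Strategy (Θ i)) (i : Fin n) :
    Measurable fun ω => bidAt s ω i :=
  (s i).measurable_bid.comp
    ((measurable_type_at i).prodMk ((measurable_value_at i).prodMk (measurable_seed_at i)))

theorem measurable_bids (s : ∀ i, Strategy (Θ i)) : Measurable fun ω => bidAt s ω :=
  measurable_pi_iff.2 (measurable_bidAt s)

theorem measurable_winProb_bidAt (s : ∀ i, Strategy (Θ i)) (i : Fin n) :
    Measurable fun ω => winProb (bidAt s ω) i :=
  (measurable_winProb i).comp (measurable_bids s)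

theorem bidAt_lt_top (s : ∀ i, Strategy (Θ i)) (ω : Sample Θ) (i : Fin n) :
    bidAt s ω i < ⊤ := (s i).bid_lt_top _ _ _

theorem bidAt_eq_bot_or (s : ∀ i, Strategy (Θ i)) (ω : Sample Θ) (i : Fin n) :
    bidAt s ω i = ⊥ ∨ 0 ≤ bidAt s ω i := (s i).bid_eq_bot_or _ _ _

theorem toReal_bidAt_nonneg (s : ∀ i, Strategy (Θ i)) (ω : Sample Θ) (i : Fin n) :
    0 ≤ (bidAt s ω i).toReal := by
  rcases bidAt_eq_bot_or s ω i with h | h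
  · simp [h]
  · exact EReal.toReal_nonneg h

theorem coe_toReal_bidAt {s : ∀ i, Strategy (Θ i)} {ω : Sample Θ} {i : Fin n}
    (h : 0 ≤ bidAt s ω i) : ((bidAt s ω i).toReal : EReal) = bidAt s ω i :=
  EReal.coe_toReal (bidAt_lt_top s ω i).ne (fun e => by simp [e] at h)

open Classical in
/-- The indicator of the event that bidder `i` inspects. -/
def inspectInd (s : ∀ i, Strategy (Θ i)) (i : Fin n) (ω : Sample Θ) : ℝ :=
  if Inspects s ω i then 1 else 0

theorem inspectInd_nonneg (s : ∀ i, Strategy (Θ i)) (i : Fin n) (ω : Sample Θ) :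
    0 ≤ inspectInd s i ω := by
  unfold inspectInd; split_ifs <;> norm_num

theorem costPaid_eq (E : Environment n Θ) (s : ∀ i, Strategy (Θ i)) (ω : Sample Θ) (i : Fin n) :
    costPaid E s ω i = inspectInd s i ω * E.cost i (ω.1.1 i) := by
  unfold costPaid inspectInd; split_ifs <;> simp

theorem inspects_of_winProb_ne_zero {s : ∀ i, Strategy (Θ i)} {ω : Sample Θ} {i : Fin n}
    (h : winProb (bidAt s ω) i ≠ 0) : Inspects s ω i := by
  obtain ⟨h0, h1⟩ := of_winProb_ne_zero h
  have hle : bidAt s ω i ≤ (s i).inspectAt (ω.1.1 i) (ω.2 i) := (s i).bid_le_inspectAt _ _ _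
  exact ⟨h0.trans hle, fun j => (h1 j).trans hle⟩

theorem winProb_le_inspectInd (s : ∀ i, Strategy (Θ i)) (ω : Sample Θ) (i : Fin n) :
    winProb (bidAt s ω) i ≤ inspectInd s i ω := by
  by_cases h : winProb (bidAt s ω) i = 0
  · rw [h]; exact inspectInd_nonneg s i ω
  · rw [inspectInd, if_pos (inspects_of_winProb_ne_zero h)]
    exact winProb_le_one _ _

/-- A bidder's own claim price never exceeds her inspection price, so only the opponents' prices
matter. -/
theorem inspects_iff (s : ∀ i, Strategy (Θ i)) (ω : Sample Θ) (i : Fin n) :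
    Inspects s ω i ↔ 0 ≤ (s i).inspectAt (ω.1.1 i) (ω.2 i) ∧
      ∀ j, j ≠ i → bidAt s ω j ≤ (s i).inspectAt (ω.1.1 i) (ω.2 i) := by
  refine and_congr_right fun _ => ⟨fun h j _ => h j, fun h j => ?_⟩
  by_cases hj : j = i
  · subst hj; exact (s j).bid_le_inspectAt _ _ _
  · exact h j hj

theorem bidAt_setValue (s : ∀ i, Strategy (Θ i)) (ω : Sample Θ) {i j : Fin n} (h : j ≠ i) (y : ℝ) :
    bidAt s (setValue i ω y) j = bidAt s ω j := by
  simp [bidAt, setValue, Function.update_of_ne h]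

theorem bidAt_setSeed (s : ∀ i, Strategy (Θ i)) (ω : Sample Θ) {i j : Fin n} (h : j ≠ i)
    (r : unitInterval) : bidAt s (setSeed i ω r) j = bidAt s ω j := by
  simp [bidAt, setSeed, Function.update_of_ne h]

/-- The inspection price is fixed before the value is learned and the opponents' prices do not
involve that value; this is the auction's counterpart of `Procedure.mem_payers_update`. -/
theorem inspectInd_setValue (s : ∀ i, Strategy (Θ i)) (ω : Sample Θ) (i : Fin n) (y : ℝ) :
    inspectInd s i (setValue i ω y) = inspectInd s i ω := by
  have : Inspects s (setValue i ω y) i ↔ Inspects s ω i := by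
    rw [inspects_iff, inspects_iff]
    refine and_congr Iff.rfl (forall₂_congr fun j hj => ?_)
    rw [bidAt_setValue s ω hj]
    rfl
  unfold inspectInd
  by_cases h : Inspects s ω i
  · rw [if_pos h, if_pos (this.2 h)]
  · rw [if_neg h, if_neg (this.not.2 h)]

theorem measurable_inspectInd (s : ∀ i, Strategy (Θ i)) (i : Fin n) :
    Measurable (inspectInd s i) := by
  classical
  have hi : Measurable fun ω : Sample Θ => (s i).inspectAt (ω.1.1 i) (ω.2 i) :=
    (s i).measurable_inspectAt.comp ((measurable_type_at i).prodMk (measurable_seed_at i))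
  refine Measurable.ite ?_ measurable_const measurable_const
  refine (measurableSet_le measurable_const hi).inter ?_
  change MeasurableSet {ω : Sample Θ | ∀ j, bidAt s ω j ≤ (s i).inspectAt (ω.1.1 i) (ω.2 i)}
  have : {ω : Sample Θ | ∀ j, bidAt s ω j ≤ (s i).inspectAt (ω.1.1 i) (ω.2 i)}
      = ⋂ j, {ω | bidAt s ω j ≤ (s i).inspectAt (ω.1.1 i) (ω.2 i)} := by ext; simp
  rw [this]
  exact MeasurableSet.iInter fun j => measurableSet_le (measurable_bidAt s j) hi

/-! ## Utilities in terms of covered calls -/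

/-- The ex post utility of bidder `i`. -/
def payoff (E : Environment n Θ) (s : ∀ i, Strategy (Θ i)) (i : Fin n) (ω : Sample Θ) : ℝ :=
  winProb (bidAt s ω) i * (ω.1.2 i - (bidAt s ω i).toReal) - costPaid E s ω i

/-- The ex post utility of bidder `i` when the inspection cost is replaced by the loss `v - κ`. -/
def callPayoff (E : Environment n Θ) (s : ∀ i, Strategy (Θ i)) (i : Fin n) (ω : Sample Θ) : ℝ :=
  winProb (bidAt s ω) i * (ω.1.2 i - (bidAt s ω i).toReal)
    - inspectInd s i ω * (ω.1.2 i - E.callValue i (ω.1.1 i) (ω.1.2 i))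

theorem measurable_netWin (s : ∀ i, Strategy (Θ i)) (i : Fin n) :
    Measurable fun ω : Sample Θ =>
      winProb (bidAt s ω) i * (ω.1.2 i - (bidAt s ω i).toReal) :=
  (measurable_winProb_bidAt s i).mul
    ((measurable_value_at i).sub (measurable_ereal_toReal.comp (measurable_bidAt s i)))

theorem measurable_payoff (E : Environment n Θ) (s : ∀ i, Strategy (Θ i)) (i : Fin n) :
    Measurable (payoff E s i) := by
  have h : payoff E s i = fun ω => winProb (bidAt s ω) i * (ω.1.2 i - (bidAt s ω i).toReal)
      - inspectInd s i ω * E.cost i (ω.1.1 i) := by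
    funext ω; rw [payoff, costPaid_eq]
  rw [h]
  exact (measurable_netWin s i).sub ((measurable_inspectInd s i).mul (measurable_cost_at E i))

theorem measurable_callPayoff (E : Environment n Θ) (s : ∀ i, Strategy (Θ i)) (i : Fin n) :
    Measurable (callPayoff E s i) :=
  (measurable_netWin s i).sub ((measurable_inspectInd s i).mul
    ((measurable_value_at i).sub (measurable_callValue_at E i)))

theorem netWin_le (s : ∀ i, Strategy (Θ i)) (i : Fin n) (ω : Sample Θ) :
    winProb (bidAt s ω) i * (ω.1.2 i - (bidAt s ω i).toReal) ≤ max (ω.1.2 i) 0 := by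
  have h0 := winProb_nonneg (bidAt s ω) i
  have h1 := winProb_le_one (bidAt s ω) i
  have hb := toReal_bidAt_nonneg s ω i
  calc _ ≤ winProb (bidAt s ω) i * max (ω.1.2 i) 0 :=
        mul_le_mul_of_nonneg_left ((sub_le_self _ hb).trans (le_max_left _ _)) h0
    _ ≤ _ := mul_le_of_le_one_left (le_max_right _ _) h1

theorem payoff_le (E : Environment n Θ) (s : ∀ i, Strategy (Θ i)) (i : Fin n) (ω : Sample Θ) :
    payoff E s i ω ≤ max (ω.1.2 i) 0 := by
  rw [payoff, costPaid_eq]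
  have := mul_nonneg (inspectInd_nonneg s i ω) (E.cost_nonneg i (ω.1.1 i))
  linarith [netWin_le s i ω]

theorem callPayoff_le (E : Environment n Θ) (s : ∀ i, Strategy (Θ i)) (i : Fin n) (ω : Sample Θ) :
    callPayoff E s i ω ≤ max (ω.1.2 i) 0 := by
  rw [callPayoff]
  have := mul_nonneg (inspectInd_nonneg s i ω)
    (sub_nonneg.2 (callValue_le E i (ω.1.1 i) (ω.1.2 i)))
  linarith [netWin_le s i ω]

/-- The slack is `(I - A)(v - κ)`: it is positive only when a bidder who has found `v > σ` does not
win for certain. -/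
theorem callPayoff_le_win (E : Environment n Θ) (s : ∀ i, Strategy (Θ i)) (i : Fin n)
    (ω : Sample Θ) : callPayoff E s i ω ≤ winProb (bidAt s ω) i *
      (E.callValue i (ω.1.1 i) (ω.1.2 i) - (bidAt s ω i).toReal) := by
  rw [callPayoff]
  have := mul_le_mul_of_nonneg_right (winProb_le_inspectInd s ω i)
    (sub_nonneg.2 (callValue_le E i (ω.1.1 i) (ω.1.2 i)))
  linarith

theorem lintegral_payoff_ne_top (E : Environment n Θ) (s : ∀ i, Strategy (Θ i)) (i : Fin n) :
    ∫⁻ ω, ENNReal.ofReal (payoff E s i ω) ∂E.auctionLaw ≠ ⊤ :=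
  lintegral_ofReal_ne_top_of_le (integrable_posPart_value E _ i) (payoff_le E s i)

theorem lintegral_callPayoff_ne_top (E : Environment n Θ) (s : ∀ i, Strategy (Θ i)) (i : Fin n) :
    ∫⁻ ω, ENNReal.ofReal (callPayoff E s i ω) ∂E.auctionLaw ≠ ⊤ :=
  lintegral_ofReal_ne_top_of_le (integrable_posPart_value E _ i) (callPayoff_le E s i)

/-- Together with `callPayoff_le_win`, this bounds utility by the payoff in a first-price auction
with value `κ`. -/
theorem utility_eq_expect_callPayoff (E : Environment n Θ) (s : ∀ i, Strategy (Θ i)) (i : Fin n) :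
    utility E s i = expect E.auctionLaw (callPayoff E s i) := by
  have hX : ∀ ω, payoff E s i ω = winProb (bidAt s ω) i * (ω.1.2 i - (bidAt s ω i).toReal)
      - inspectInd s i ω * E.cost i (ω.1.1 i) := fun ω => by rw [payoff, costPaid_eq]
  have h1 := lintegral_payoff_ne_top E s i
  have h2 := lintegral_callPayoff_ne_top E s i
  simp only [hX] at h1
  have := expect_cost_eq E (Measure.pi fun _ : Fin n => (volume : Measure unitInterval)) i
    (measurable_netWin s i) (measurable_inspectInd s i) (inspectInd_nonneg s i)
    (inspectInd_setValue s · i) h1 h2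
  change expect E.auctionLaw (payoff E s i) = _
  rw [funext hX]
  exact this

/-! ## Deviations -/

/-- The strategy that behaves as if the covered call value were known and the claim price were
`φ κ r`; the function `φ · r` should be monotone. -/
def callStrategy (E : Environment n Θ) (i : Fin n) (φ : ℝ → unitInterval → ℝ)
    (hφ : Measurable fun x : ℝ × unitInterval => φ x.1 x.2) : Strategy (Θ i) where
  inspectAt t r := if strikePrice (E.F i t) (E.cost i t) = ⊤ then ⊤ else
    (φ (strikePrice (E.F i t) (E.cost i t)).toReal r : EReal)
  claimAt _ v r := (φ v r : EReal)
  claimAt_lt_top _ _ _ := EReal.coe_lt_top _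
  measurable_inspectAt := by
    have hs : Measurable fun x : Θ i × unitInterval => strikePrice (E.F i x.1) (E.cost i x.1) :=
      (E.measurable_strikePrice i).comp measurable_fst
    refine Measurable.ite (hs (measurableSet_singleton ⊤)) measurable_const ?_
    exact measurable_coe_real_ereal.comp
      (hφ.comp ((measurable_ereal_toReal.comp hs).prodMk measurable_snd))
  measurable_claimAt := measurable_coe_real_ereal.comp (hφ.comp measurable_snd)

/-- Monotonicity gives `min (φ σ) (φ v) = φ (min σ v)`. With a free inspection the bidder inspects
at the start and the price is `φ v = φ κ`. -/
theorem bid_callStrategy (E : Environment n Θ) (i : Fin n) {φ : ℝ → unitInterval → ℝ}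
    (hφ : Measurable fun x : ℝ × unitInterval => φ x.1 x.2) (hmono : ∀ r, Monotone (φ · r))
    (t : Θ i) (v : ℝ) (r : unitInterval) :
    (callStrategy E i φ hφ).bid t v r =
      if 0 ≤ φ (E.callValue i t v) r then (φ (E.callValue i t v) r : EReal) else ⊥ := by
  have hmin : min ((callStrategy E i φ hφ).inspectAt t r) ((callStrategy E i φ hφ).claimAt t v r)
      = (φ (E.callValue i t v) r : EReal) := by
    rcases strikePrice_cases E i t with ⟨-, h⟩ | ⟨x, h, -⟩
    · rw [callValue_of_top E h]
      simp [callStrategy, h]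
    · rw [callValue_of_coe E h]
      simp only [callStrategy, h, EReal.coe_ne_top, if_false, EReal.toReal_coe]
      rw [(hmono r).map_min]
      exact (EReal.coe_strictMono.monotone.map_min).symm
  rw [Strategy.bid, hmin]
  simp only [EReal.coe_nonneg]

open Classical in
/-- The net value `κ - φ κ` obtained by `callStrategy` if nobody else claims the item at a price at
least `φ κ`. -/
def outrightGain (E : Environment n Θ) (s : ∀ i, Strategy (Θ i)) (i : Fin n)
    (φ : ℝ → unitInterval → ℝ) (ω : Sample Θ) : ℝ :=
  if 0 ≤ φ (E.callValue i (ω.1.1 i) (ω.1.2 i)) (ω.2 i) ∧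
      ∀ j, j ≠ i → bidAt s ω j < φ (E.callValue i (ω.1.1 i) (ω.1.2 i)) (ω.2 i) then
    E.callValue i (ω.1.1 i) (ω.1.2 i) - φ (E.callValue i (ω.1.1 i) (ω.1.2 i)) (ω.2 i)
  else 0

theorem outrightGain_nonneg (E : Environment n Θ) (s : ∀ i, Strategy (Θ i)) (i : Fin n)
    {φ : ℝ → unitInterval → ℝ} (hle : ∀ k r, 0 ≤ φ k r → φ k r ≤ k) (ω : Sample Θ) :
    0 ≤ outrightGain E s i φ ω := by
  unfold outrightGain
  split_ifs with h
  · exact sub_nonneg.2 (hle _ _ h.1)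
  · exact le_rfl

/-- This strategy never pays for an inspection that finds `v > σ` without winning, except in a tie
at the inspection price `φ σ`. There she could pay and still lose the lottery, which `htie`
excludes. Ties at other prices only help, because `φ κ ≤ κ` for any claim actually made. -/
theorem outrightGain_le_callPayoff (E : Environment n Θ) (s : ∀ i, Strategy (Θ i)) (i : Fin n)
    {φ : ℝ → unitInterval → ℝ} (hφ : Measurable fun x : ℝ × unitInterval => φ x.1 x.2)
    (hmono : ∀ r, Monotone (φ · r)) (hle : ∀ k r, 0 ≤ φ k r → φ k r ≤ k) (ω : Sample Θ)
    (htie : ∀ j, j ≠ i → ∀ x : ℝ,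
      strikePrice (E.F i (ω.1.1 i)) (E.cost i (ω.1.1 i)) = x → 0 ≤ φ x (ω.2 i) →
        bidAt s ω j ≠ φ x (ω.2 i)) :
    outrightGain E s i φ ω ≤ callPayoff E (Function.update s i (callStrategy E i φ hφ)) i ω := by
  set s' := Function.update s i (callStrategy E i φ hφ) with hs'
  have hoth : ∀ j, j ≠ i → bidAt s' ω j = bidAt s ω j := fun j hj => by
    simp only [bidAt, hs', Function.update_of_ne hj]
  set k := E.callValue i (ω.1.1 i) (ω.1.2 i) with hk
  have hown : bidAt s' ω i = if 0 ≤ φ k (ω.2 i) then (φ k (ω.2 i) : EReal) else ⊥ := by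
    simp only [bidAt, hs', Function.update_self]
    exact bid_callStrategy E i hφ hmono _ _ _
  have hins : (s' i).inspectAt (ω.1.1 i) (ω.2 i)
      = (callStrategy E i φ hφ).inspectAt (ω.1.1 i) (ω.2 i) := by
    simp only [hs', Function.update_self]
  have hwin : (0 ≤ φ k (ω.2 i) ∧ ∀ j, j ≠ i → bidAt s ω j < φ k (ω.2 i)) →
      winProb (bidAt s' ω) i = 1 ∧ (bidAt s' ω i).toReal = φ k (ω.2 i) := by
    rintro ⟨h0, h1⟩
    rw [if_pos h0] at hown
    refine ⟨winProb_eq_one ?_ fun j hj => ?_, by rw [hown, EReal.toReal_coe]⟩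
    · rw [hown]; exact_mod_cast h0
    · rw [hown, hoth j hj]; exact h1 j hj
  have hwin' : winProb (bidAt s' ω) i ≠ 0 →
      0 ≤ φ k (ω.2 i) ∧ (bidAt s' ω i).toReal = φ k (ω.2 i) := by
    intro h
    by_cases h0 : 0 ≤ φ k (ω.2 i)
    · rw [if_pos h0] at hown
      exact ⟨h0, by rw [hown, EReal.toReal_coe]⟩
    · rw [if_neg h0] at hown
      have := (of_winProb_ne_zero h).1
      simp [hown] at this
  -- If `κ = v`, inspecting carries no amortized loss and the payoff is that of a first-price
  -- auction.
  by_cases hkv : k = ω.1.2 i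
  · have hY : callPayoff E s' i ω
        = winProb (bidAt s' ω) i * (k - (bidAt s' ω i).toReal) := by
      rw [callPayoff, ← hk, hkv]; ring
    rw [hY, outrightGain, ← hk]
    split_ifs with h
    · obtain ⟨h1, h2⟩ := hwin h
      rw [h1, h2, one_mul]
    · by_cases hw : winProb (bidAt s' ω) i = 0
      · rw [hw, zero_mul]
      · obtain ⟨h1, h2⟩ := hwin' hw
        rw [h2]
        exact mul_nonneg (winProb_nonneg _ _) (sub_nonneg.2 (hle _ _ h1))
  -- Otherwise `κ = σ < v`: she inspects and claims at the same clock value, so without ties she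
  -- inspects exactly when she wins.
  · obtain ⟨x, hx⟩ : ∃ x : ℝ, strikePrice (E.F i (ω.1.1 i)) (E.cost i (ω.1.1 i)) = x := by
      rcases strikePrice_cases E i (ω.1.1 i) with ⟨-, h⟩ | ⟨x, h, -⟩
      · exact absurd (callValue_of_top E h _) hkv
      · exact ⟨x, h⟩
    have hkx : k = x := by
      rw [hk, callValue_of_coe E hx] at hkv ⊢
      exact (min_choice x (ω.1.2 i)).resolve_right hkv
    have hinsx : (s' i).inspectAt (ω.1.1 i) (ω.2 i) = (φ k (ω.2 i) : EReal) := by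
      rw [hins, hkx]
      simp [callStrategy, hx]
    by_cases hI : Inspects s' ω i
    · have hI' := (inspects_iff s' ω i).1 hI
      rw [hinsx] at hI'
      have h0 : 0 ≤ φ k (ω.2 i) := by exact_mod_cast hI'.1
      have h1 : ∀ j, j ≠ i → bidAt s ω j < φ k (ω.2 i) := fun j hj => by
        refine lt_of_le_of_ne (hoth j hj ▸ hI'.2 j hj) ?_
        have := htie j hj x hx
        rw [← hkx] at this
        exact this h0
      obtain ⟨h2, h3⟩ := hwin ⟨h0, h1⟩
      rw [callPayoff, h2, h3, inspectInd, if_pos hI, outrightGain, ← hk, if_pos ⟨h0, h1⟩]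
      linarith
    · have hw : winProb (bidAt s' ω) i = 0 := by
        by_contra h
        exact hI (inspects_of_winProb_ne_zero h)
      rw [callPayoff, hw, inspectInd, if_neg hI, outrightGain, ← hk, if_neg]
      · simp
      · intro h
        rw [(hwin h).1] at hw
        exact one_ne_zero hw

theorem le_utility_callStrategy (E : Environment n Θ) (s : ∀ i, Strategy (Θ i)) (i : Fin n)
    {φ : ℝ → unitInterval → ℝ} (hφ : Measurable fun x : ℝ × unitInterval => φ x.1 x.2)
    (hmono : ∀ r, Monotone (φ · r)) (hle : ∀ k r, 0 ≤ φ k r → φ k r ≤ k)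
    (htie : ∀ᵐ ω ∂E.auctionLaw, ∀ j, j ≠ i → ∀ x : ℝ,
      strikePrice (E.F i (ω.1.1 i)) (E.cost i (ω.1.1 i)) = x → 0 ≤ φ x (ω.2 i) →
        bidAt s ω j ≠ φ x (ω.2 i)) :
    ((∫⁻ ω, ENNReal.ofReal (outrightGain E s i φ ω) ∂E.auctionLaw : ENNReal) : EReal)
      ≤ utility E (Function.update s i (callStrategy E i φ hφ)) i := by
  rw [utility_eq_expect_callPayoff, ← expect_of_nonneg (outrightGain_nonneg E s i hle)]
  exact expect_mono_ae (htie.mono fun ω h => outrightGain_le_callPayoff E s i hφ hmono hle ω h)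

/-! ## Equilibria -/

/-- The constant `φ = -1` means staying out: the threshold is never reached, and an inspection at
`⊤` occurs only when it is free. -/
theorem utility_nonneg {E : Environment n Θ} {s : ∀ i, Strategy (Θ i)} (hs : IsEquilibrium E s)
    (i : Fin n) : 0 ≤ utility E s i := by
  refine le_trans ?_ ((le_utility_callStrategy E s i (φ := fun _ _ => -1) measurable_const
    (fun _ => monotone_const) (fun k r h => by norm_num at h)
    (Filter.Eventually.of_forall fun ω j _ x _ h => by norm_num at h)).trans (hs i _))
  exact EReal.coe_ennreal_nonneg _

/-- Payoffs are bounded above by `v⁺`, so only an expected utility of `-∞` could prevent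
integrability, and an equilibrium rules it out. -/
theorem integrable_payoff {E : Environment n Θ} {s : ∀ i, Strategy (Θ i)}
    (hs : IsEquilibrium E s) (i : Fin n) : Integrable (payoff E s i) E.auctionLaw :=
  integrable_of_expect_ne_bot (measurable_payoff E s i) (lintegral_payoff_ne_top E s i)
    (ne_bot_of_le_ne_bot EReal.zero_ne_bot (utility_nonneg hs i))

theorem integrable_callPayoff {E : Environment n Θ} {s : ∀ i, Strategy (Θ i)}
    (hs : IsEquilibrium E s) (i : Fin n) : Integrable (callPayoff E s i) E.auctionLaw := by
  refine integrable_of_expect_ne_bot (measurable_callPayoff E s i)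
    (lintegral_callPayoff_ne_top E s i) ?_
  rw [← utility_eq_expect_callPayoff]
  exact ne_bot_of_le_ne_bot EReal.zero_ne_bot (utility_nonneg hs i)

theorem utility_eq_integral_payoff {E : Environment n Θ} {s : ∀ i, Strategy (Θ i)}
    (hs : IsEquilibrium E s) (i : Fin n) :
    utility E s i = ((∫ ω, payoff E s i ω ∂E.auctionLaw : ℝ) : EReal) :=
  expect_eq_integral (integrable_payoff hs i)

theorem integral_payoff_eq {E : Environment n Θ} {s : ∀ i, Strategy (Θ i)}
    (hs : IsEquilibrium E s) (i : Fin n) :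
    ∫ ω, payoff E s i ω ∂E.auctionLaw = ∫ ω, callPayoff E s i ω ∂E.auctionLaw := by
  have h := utility_eq_integral_payoff hs i
  rw [utility_eq_expect_callPayoff, expect_eq_integral (integrable_callPayoff hs i)] at h
  exact_mod_cast h.symm

theorem payment_nonneg (s : ∀ i, Strategy (Θ i)) (i : Fin n) (ω : Sample Θ) :
    0 ≤ winProb (bidAt s ω) i * (bidAt s ω i).toReal :=
  mul_nonneg (winProb_nonneg _ _) (toReal_bidAt_nonneg s ω i)

theorem measurable_payment (s : ∀ i, Strategy (Θ i)) (i : Fin n) :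
    Measurable fun ω : Sample Θ => winProb (bidAt s ω) i * (bidAt s ω i).toReal :=
  (measurable_winProb_bidAt s i).mul (measurable_ereal_toReal.comp (measurable_bidAt s i))

/-- The payment equals `A v - I c` minus the payoff, hence is at most `v⁺ + |payoff|`. -/
theorem integrable_payment {E : Environment n Θ} {s : ∀ i, Strategy (Θ i)}
    (hs : IsEquilibrium E s) (i : Fin n) :
    Integrable (fun ω => winProb (bidAt s ω) i * (bidAt s ω i).toReal) E.auctionLaw := by
  have hv := integrable_posPart_value E
    (Measure.pi fun _ : Fin n => (volume : Measure unitInterval)) i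
  refine (hv.add (integrable_payoff hs i).norm).mono'
    (measurable_payment s i).aestronglyMeasurable ?_
  filter_upwards with ω
  rw [Real.norm_eq_abs, abs_of_nonneg (payment_nonneg s i ω)]
  have h1 := neg_abs_le (payoff E s i ω)
  have h2 : winProb (bidAt s ω) i * ω.1.2 i ≤ max (ω.1.2 i) 0 :=
    (mul_le_mul_of_nonneg_left (le_max_left _ _) (winProb_nonneg _ _)).trans
      (mul_le_of_le_one_left (le_max_right _ _) (winProb_le_one _ _))
  have h3 := mul_nonneg (inspectInd_nonneg s i ω) (E.cost_nonneg i (ω.1.1 i))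
  simp only [Pi.add_apply, Real.norm_eq_abs]
  have h4 : payoff E s i ω = winProb (bidAt s ω) i * ω.1.2 i
      - winProb (bidAt s ω) i * (bidAt s ω i).toReal
      - inspectInd s i ω * E.cost i (ω.1.1 i) := by rw [payoff, costPaid_eq]; ring
  linarith

/-- Welfare is the sum of utilities and payments. -/
theorem auctionWelfare_eq {E : Environment n Θ} {s : ∀ i, Strategy (Θ i)}
    (hs : IsEquilibrium E s) :
    auctionWelfare E s = ((∑ i, (∫ ω, payoff E s i ω ∂E.auctionLaw
      + ∫ ω, winProb (bidAt s ω) i * (bidAt s ω i).toReal ∂E.auctionLaw) : ℝ) : EReal) := by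
  have h : ∀ ω, ∑ i, (winProb (bidAt s ω) i * ω.1.2 i - costPaid E s ω i)
      = ∑ i, (payoff E s i ω + winProb (bidAt s ω) i * (bidAt s ω i).toReal) := fun ω =>
    Finset.sum_congr rfl fun i _ => by rw [payoff]; ring
  have hi : ∀ i, Integrable (fun ω =>
      payoff E s i ω + winProb (bidAt s ω) i * (bidAt s ω i).toReal) E.auctionLaw :=
    fun i => (integrable_payoff hs i).add (integrable_payment hs i)
  rw [auctionWelfare, funext h, expect_eq_integral (integrable_finsetSum _ fun i _ => hi i),
    integral_finsetSum _ fun i _ => hi i]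
  congr 1
  exact Finset.sum_congr rfl fun i _ =>
    integral_add (integrable_payoff hs i) (integrable_payment hs i)

end Auction

/-! ## The welfare guarantee -/

section Guarantee

variable {n : ℕ} {Θ : Fin n → Type u} [∀ i, MeasurableSpace (Θ i)]

theorem le_ofReal_of_coe_le {L : ENNReal} {x : ℝ} (h : (L : EReal) ≤ (x : EReal)) :
    L ≤ ENNReal.ofReal x := by
  have := EReal.toENNReal_le_toENNReal h
  rwa [EReal.toENNReal_coe, EReal.real_coe_toENNReal] at this

theorem integral_bestCall_auctionLaw (E : Environment n Θ) :
    ∫ ω, E.bestCall ω.1 ∂E.auctionLaw = ∫ p, E.bestCall p ∂E.law :=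
  integral_bestCall E _

theorem measurable_outrightGain (E : Environment n Θ) (s : ∀ i, Strategy (Θ i)) (i : Fin n)
    {φ : ℝ → unitInterval → ℝ} (hφ : Measurable fun x : ℝ × unitInterval => φ x.1 x.2) :
    Measurable (outrightGain E s i φ) := by
  have hk := measurable_callValue_at (S := Fin n → unitInterval) E i
  have hf : Measurable fun ω : Sample Θ => φ (E.callValue i (ω.1.1 i) (ω.1.2 i)) (ω.2 i) :=
    hφ.comp (hk.prodMk (measurable_seed_at i))
  refine Measurable.ite ?_ (hk.sub hf) measurable_const
  refine (measurableSet_le measurable_const hf).inter ?_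
  have : {ω : Sample Θ | ∀ j, j ≠ i →
      bidAt s ω j < φ (E.callValue i (ω.1.1 i) (ω.1.2 i)) (ω.2 i)}
      = ⋂ (j) (_ : j ≠ i), {ω | bidAt s ω j < φ (E.callValue i (ω.1.1 i) (ω.1.2 i)) (ω.2 i)} := by
    ext; simp
  change MeasurableSet {ω : Sample Θ | ∀ j, j ≠ i →
      bidAt s ω j < φ (E.callValue i (ω.1.1 i) (ω.1.2 i)) (ω.2 i)}
  rw [this]
  exact MeasurableSet.iInter fun j => MeasurableSet.iInter fun _ =>
    measurableSet_lt (measurable_bidAt s j) (measurable_coe_real_ereal.comp hf)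

/-- Claiming at the fraction `1 - exp (-r)` of a positive covered call value `k`. -/
def shade (k : ℝ) (r : unitInterval) : ℝ :=
  if 0 < k then (1 - Real.exp (-(r : ℝ))) * k else -1

theorem shade_factor_nonneg (r : unitInterval) : 0 ≤ 1 - Real.exp (-(r : ℝ)) :=
  sub_nonneg.2 (Real.exp_le_one_iff.2 (neg_nonpos.2 r.2.1))

theorem measurable_shade : Measurable fun x : ℝ × unitInterval => shade x.1 x.2 :=
  Measurable.ite (measurableSet_lt measurable_const measurable_fst) (by fun_prop) measurable_const

theorem shade_mono (r : unitInterval) : Monotone (shade · r) := by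
  intro k l h
  have := shade_factor_nonneg r
  simp only [shade]
  split_ifs with h1 h2
  · exact mul_le_mul_of_nonneg_left h this
  · linarith
  · nlinarith
  · exact le_rfl

theorem pos_of_shade_nonneg {k : ℝ} {r : unitInterval} (h : 0 ≤ shade k r) : 0 < k := by
  by_contra hk
  rw [shade, if_neg hk] at h
  norm_num at h

theorem shade_le (k : ℝ) (r : unitInterval) (h : 0 ≤ shade k r) : shade k r ≤ k := by
  have hk := pos_of_shade_nonneg h
  rw [shade, if_pos hk]
  nlinarith [Real.exp_pos (-(r : ℝ))]

/-- For `k > 0` the shaded price is injective in the seed, so at most one seed produces a tie with a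
given price. -/
theorem subsingleton_shade_eq (k : ℝ) (b : EReal) :
    {r : unitInterval | 0 ≤ shade k r ∧ b = shade k r}.Subsingleton := by
  rintro r ⟨h1, h2⟩ r' ⟨-, h2'⟩
  have hk := pos_of_shade_nonneg h1
  have e : shade k r = shade k r' := by exact_mod_cast h2.symm.trans h2'
  simp only [shade, if_pos hk] at e
  have e' := mul_right_cancel₀ hk.ne' e
  have : Real.exp (-(r : ℝ)) = Real.exp (-(r' : ℝ)) := by linarith
  exact Subtype.ext (neg_injective (Real.exp_injective this))

/-- Resample the seed of `i`, on which the opponents' prices do not depend: ties need a particular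
seed, and the uniform law has no atoms. -/
theorem ae_ne_shade (E : Environment n Θ) (s : ∀ i, Strategy (Θ i)) (i : Fin n) :
    ∀ᵐ ω ∂E.auctionLaw, ∀ j, j ≠ i → ∀ x : ℝ,
      strikePrice (E.F i (ω.1.1 i)) (E.cost i (ω.1.1 i)) = x → 0 ≤ shade x (ω.2 i) →
        bidAt s ω j ≠ shade x (ω.2 i) := by
  refine ae_all_iff.2 fun j => ?_
  by_cases hj : j = i
  · exact Filter.Eventually.of_forall fun ω h => absurd hj h
  let x : Sample Θ → ℝ := fun ω => (strikePrice (E.F i (ω.1.1 i)) (E.cost i (ω.1.1 i))).toReal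
  have hx : Measurable x :=
    measurable_ereal_toReal.comp ((E.measurable_strikePrice i).comp (measurable_type_at i))
  have hsh : Measurable fun ω : Sample Θ => shade (x ω) (ω.2 i) :=
    measurable_shade.comp (hx.prodMk (measurable_seed_at i))
  let B : Set (Sample Θ) := {ω | 0 ≤ shade (x ω) (ω.2 i) ∧ bidAt s ω j = shade (x ω) (ω.2 i)}
  have hB : MeasurableSet B := (measurableSet_le measurable_const hsh).inter
    (measurableSet_eq_fun (measurable_bidAt s j) (measurable_coe_real_ereal.comp hsh))
  have h0 : E.auctionLaw B = 0 := by
    rw [← lintegral_indicator_one hB, lintegral_setSeed E i (measurable_one.indicator hB)]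
    refine (lintegral_congr fun ω => ?_).trans lintegral_zero
    have e : ∀ r, B.indicator (1 : Sample Θ → ENNReal) (setSeed i ω r)
        = {r : unitInterval | 0 ≤ shade (x ω) r ∧ bidAt s ω j = shade (x ω) r}.indicator 1 r := by
      intro r
      have : setSeed i ω r ∈ B ↔
          r ∈ {r : unitInterval | 0 ≤ shade (x ω) r ∧ bidAt s ω j = shade (x ω) r} := by
        have h2 : (setSeed i ω r).2 i = r := by simp [setSeed]
        have h3 : x (setSeed i ω r) = x ω := rfl
        simp only [B, Set.mem_ofPred_eq, h2, h3, bidAt_setSeed s ω hj]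
      by_cases h : r ∈ {r : unitInterval | 0 ≤ shade (x ω) r ∧ bidAt s ω j = shade (x ω) r}
      · rw [Set.indicator_of_mem h, Set.indicator_of_mem (this.2 h)]; rfl
      · rw [Set.indicator_of_notMem h, Set.indicator_of_notMem (this.not.2 h)]
    simp only [e]
    have hsub := subsingleton_shade_eq (x ω) (bidAt s ω j)
    rw [lintegral_indicator_one hsub.measurableSet]
    exact hsub.measure_zero volume
  filter_upwards [measure_eq_zero_iff_ae_notMem.1 h0] with ω hω _ y hy h1 h2
  apply hω
  have : x ω = y := by simp only [x, hy, EReal.toReal_coe]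
  exact ⟨by rw [this]; exact h1, by rw [this]; exact h2⟩

/-- The net gain at seed `r` is `k exp (-r)`, and the price exceeds `p` for `r > a` with `exp (-a) =
1 - p / k`. Integrating from `a` to `1` gives `k - p - k / e`. -/
theorem le_lintegral_shade {k p : ℝ} (hk : 0 < k) (hp : 0 ≤ p) :
    ENNReal.ofReal ((1 - 1 / Real.exp 1) * k - p)
      ≤ ∫⁻ r : unitInterval,
        ENNReal.ofReal (if p < shade k r then k - shade k r else 0) := by
  rcases le_or_gt ((1 - 1 / Real.exp 1) * k - p) 0 with h | h
  · rw [ENNReal.ofReal_of_nonpos h]; exact zero_le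
  have he : 1 / Real.exp 1 = Real.exp (-1) := by rw [Real.exp_neg, one_div]
  rw [he] at h ⊢
  have hq : 0 < 1 - p / k := by
    rw [sub_pos, div_lt_one hk]
    nlinarith [Real.exp_pos (-1)]
  set a := -Real.log (1 - p / k) with ha
  have hexp : Real.exp (-a) = 1 - p / k := by rw [ha, neg_neg, Real.exp_log hq]
  have ha0 : 0 ≤ a := by
    rw [ha, Left.nonneg_neg_iff]
    exact Real.log_nonpos hq.le (sub_le_self _ (div_nonneg hp hk.le))
  -- This uses the remaining case `p < (1 - 1/e) k`, in which the range of winning seeds is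
  -- nonempty.
  have ha1 : a ≤ 1 := by
    have : Real.exp (-1) < Real.exp (-a) := by
      rw [hexp, lt_sub_comm, div_lt_iff₀ hk]
      linarith
    linarith [Real.exp_lt_exp.1 this]
  have hI : ∫ x in a..1, k * Real.exp (-x) = (1 - Real.exp (-1)) * k - p := by
    have hd : ∀ x ∈ Set.uIcc a 1, HasDerivAt (fun x => -(k * Real.exp (-x)))
        (k * Real.exp (-x)) x := fun x _ => by
      have : HasDerivAt (fun x => -(k * Real.exp (-x))) (-(k * (Real.exp (-x) * -1))) x :=
        (((hasDerivAt_id x).neg.exp).const_mul k).neg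
      convert this using 1
      ring
    rw [intervalIntegral.integral_eq_sub_of_hasDerivAt hd
      (Continuous.intervalIntegrable (by fun_prop) _ _), hexp]
    field_simp
    ring
  rw [← hI, intervalIntegral.integral_of_le ha1, ofReal_integral_eq_lintegral_ofReal]
  rotate_left
  · exact (Continuous.integrableOn_Icc (by fun_prop)).mono_set Set.Ioc_subset_Icc_self
  · exact Filter.Eventually.of_forall fun x => by positivity
  have hsub : ∫⁻ r : unitInterval, ENNReal.ofReal (if p < shade k r then k - shade k r else 0)
      = ∫⁻ x in Set.Icc (0 : ℝ) 1, ENNReal.ofReal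
        (if p < (1 - Real.exp (-x)) * k then k - (1 - Real.exp (-x)) * k else 0) := by
    rw [← lintegral_subtype_comap measurableSet_Icc]
    refine lintegral_congr fun r => ?_
    simp only [shade, if_pos hk]
  rw [hsub]
  refine le_trans ?_ (lintegral_mono_set (s := Set.Ioc a 1)
    (Set.Ioc_subset_Icc_self.trans (Set.Icc_subset_Icc_left ha0)))
  refine setLIntegral_mono' measurableSet_Ioc fun x hx => ENNReal.ofReal_le_ofReal ?_
  rw [if_pos]
  · linarith
  · have : Real.exp (-x) < 1 - p / k := by
      rw [← hexp]; exact Real.exp_lt_exp.2 (neg_lt_neg hx.1)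
    have h2 : p / k < 1 - Real.exp (-x) := by linarith
    rwa [div_lt_iff₀ hk] at h2

/-- The revenue of the auction. -/
def revenue (s : ∀ i, Strategy (Θ i)) (ω : Sample Θ) : ℝ :=
  ∑ i, winProb (bidAt s ω) i * (bidAt s ω i).toReal

theorem revenue_nonneg (s : ∀ i, Strategy (Θ i)) (ω : Sample Θ) : 0 ≤ revenue s ω :=
  Finset.sum_nonneg fun i _ => payment_nonneg s i ω

theorem measurable_revenue (s : ∀ i, Strategy (Θ i)) : Measurable (revenue s) :=
  Finset.measurable_fun_sum _ fun i _ => measurable_payment s i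

/-- If the item is sold, all tied winners pay the same price, so revenue is the highest claim price;
otherwise every price is negative. -/
theorem bidAt_le_revenue (s : ∀ i, Strategy (Θ i)) (ω : Sample Θ) (j : Fin n) :
    bidAt s ω j ≤ (revenue s ω : EReal) := by
  rcases winProb_eq_zero_or_exists_max (bidAt s ω) with h | ⟨i, hi⟩
  · exact (h j).2.le.trans (by exact_mod_cast revenue_nonneg s ω)
  · have : revenue s ω = (bidAt s ω i).toReal := by
      have e : ∀ j, winProb (bidAt s ω) j * (bidAt s ω j).toReal
          = winProb (bidAt s ω) j * (bidAt s ω i).toReal := fun j => by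
        by_cases h : winProb (bidAt s ω) j = 0
        · rw [h, zero_mul, zero_mul]
        · rw [le_antisymm (hi.2 j) ((of_winProb_ne_zero h).2 i)]
      rw [revenue, Finset.sum_congr rfl fun j _ => e j, ← Finset.sum_mul, sum_winProb hi, one_mul]
    rw [this, coe_toReal_bidAt hi.1]
    exact hi.2 j

/-- Since all outright gains are nonnegative, it suffices to count the bidder with the highest `κ`.
Resampling separates the seed that shades her deviation from the seed behind her equilibrium bid, so
revenue at the original sample point can serve as the price `p` that she has to beat. -/
theorem le_sum_lintegral_outrightGain (E : Environment n Θ) (s : ∀ i, Strategy (Θ i)) :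
    ∫⁻ ω, ENNReal.ofReal ((1 - 1 / Real.exp 1) * E.bestCall ω.1 - revenue s ω) ∂E.auctionLaw
      ≤ ∑ i, ∫⁻ ω, ENNReal.ofReal (outrightGain E s i shade ω) ∂E.auctionLaw := by
  have hm : ∀ i, Measurable fun ω => ENNReal.ofReal (outrightGain E s i shade ω) := fun i =>
    (measurable_outrightGain E s i measurable_shade).ennreal_ofReal
  have hm' : ∀ i, Measurable fun ω =>
      ∫⁻ r, ENNReal.ofReal (outrightGain E s i shade (setSeed i ω r)) := fun i =>
    Measurable.lintegral_prod_right' ((hm i).comp (measurable_setSeed i))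
  rw [Finset.sum_congr rfl fun i _ => lintegral_setSeed E i (hm i),
    ← lintegral_finsetSum _ fun i _ => hm' i]
  refine lintegral_mono fun ω => ?_
  have hR := revenue_nonneg s ω
  rcases bestCall_eq_zero_or E ω.1 with h | ⟨i, hi, h⟩
  · rw [h, ENNReal.ofReal_of_nonpos (by linarith)]
    exact zero_le
  · rw [h]
    refine (le_lintegral_shade hi hR).trans (le_trans (lintegral_mono fun r => ?_)
      (Finset.single_le_sum (f := fun i =>
        ∫⁻ r, ENNReal.ofReal (outrightGain E s i shade (setSeed i ω r)))
        (fun _ _ => zero_le) (Finset.mem_univ i)))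
    refine ENNReal.ofReal_le_ofReal ?_
    have e2 : (setSeed i ω r).2 i = r := by simp [setSeed]
    have e1 : (setSeed i ω r).1 = ω.1 := rfl
    split_ifs with hlt
    · rw [outrightGain, if_pos]
      · rw [e1, e2]
      · rw [e1, e2]
        refine ⟨hR.trans hlt.le, fun j hj => ?_⟩
        rw [bidAt_setSeed s ω hj]
        exact (bidAt_le_revenue s ω j).trans_lt (by exact_mod_cast hlt)
    · exact outrightGain_nonneg E s i shade_le _

theorem auctionWelfare_ge {E : Environment n Θ} {s : ∀ i, Strategy (Θ i)}
    (hs : IsEquilibrium E s) :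
    (((1 - 1 / Real.exp 1) * ∫ p, E.bestCall p ∂E.law : ℝ) : EReal) ≤ auctionWelfare E s := by
  have hu : ∀ i, 0 ≤ ∫ ω, payoff E s i ω ∂E.auctionLaw := fun i => by
    have := utility_nonneg hs i
    rw [utility_eq_integral_payoff hs i] at this
    exact_mod_cast this
  have hdev : ∀ i, ∫⁻ ω, ENNReal.ofReal (outrightGain E s i shade ω) ∂E.auctionLaw
      ≤ ENNReal.ofReal (∫ ω, payoff E s i ω ∂E.auctionLaw) := fun i => by
    refine le_ofReal_of_coe_le ?_
    rw [← utility_eq_integral_payoff hs i]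
    exact (le_utility_callStrategy E s i measurable_shade shade_mono shade_le
      (ae_ne_shade E s i)).trans (hs i _)
  have hK : Integrable (fun ω => E.bestCall ω.1) E.auctionLaw := integrable_bestCall E _
  have hRint : Integrable (revenue s) E.auctionLaw :=
    integrable_finsetSum _ fun i _ => integrable_payment hs i
  have hc : 0 ≤ 1 - 1 / Real.exp 1 := by
    rw [sub_nonneg, div_le_one (Real.exp_pos 1)]
    exact Real.one_le_exp zero_le_one
  have hRe : ∫ ω, revenue s ω ∂E.auctionLaw
      = ∑ i, ∫ ω, winProb (bidAt s ω) i * (bidAt s ω i).toReal ∂E.auctionLaw :=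
    integral_finsetSum _ fun i _ => integrable_payment hs i
  rw [auctionWelfare_eq hs, EReal.coe_le_coe_iff, Finset.sum_add_distrib, ← hRe]
  have hsum : 0 ≤ ∑ i, ∫ ω, payoff E s i ω ∂E.auctionLaw := Finset.sum_nonneg fun i _ => hu i
  have hRn : 0 ≤ ∫ ω, revenue s ω ∂E.auctionLaw := integral_nonneg (revenue_nonneg s)
  rw [← ENNReal.ofReal_le_ofReal_iff (add_nonneg hsum hRn), ENNReal.ofReal_add hsum hRn,
    ENNReal.ofReal_sum_of_nonneg fun i _ => hu i,
    ← integral_bestCall_auctionLaw,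
    ← integral_const_mul, ofReal_integral_eq_lintegral_ofReal (hK.const_mul _)
      (Filter.Eventually.of_forall fun ω => mul_nonneg hc (bestCall_nonneg E _)),
    ofReal_integral_eq_lintegral_ofReal hRint (Filter.Eventually.of_forall (revenue_nonneg s))]
  refine le_trans ?_ (add_le_add_left ((le_sum_lintegral_outrightGain E s).trans
    (Finset.sum_le_sum fun i _ => hdev i)) _)
  rw [← lintegral_add_right _ (measurable_revenue s).ennreal_ofReal]
  refine lintegral_mono fun ω => ?_
  -- The gain bound is truncated at zero; subadditivity of `ENNReal.ofReal` suffices to add the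
  -- revenue back.
  rw [show (1 - 1 / Real.exp 1) * E.bestCall ω.1
    = ((1 - 1 / Real.exp 1) * E.bestCall ω.1 - revenue s ω) + revenue s ω by ring]
  refine ENNReal.ofReal_add_le.trans ?_
  simp

end Guarantee

/-! ## Independence of the covered calls and claim prices -/

section Independence

variable {n : ℕ} {Θ : Fin n → Type u} [∀ i, MeasurableSpace (Θ i)]

theorem lintegral_pi_prod {α : Fin n → Type*} [∀ i, MeasurableSpace (α i)]
    (μ : ∀ i, Measure (α i)) [∀ i, IsProbabilityMeasure (μ i)] (J : Finset (Fin n))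
    {f : ∀ i, α i → ENNReal} (hf : ∀ i, Measurable (f i)) :
    ∫⁻ x, ∏ i ∈ J, f i (x i) ∂Measure.pi μ = ∏ i ∈ J, ∫⁻ y, f i y ∂μ i := by
  refine (lintegral_prod_eq_prod_lintegral_of_indepFun J (fun i (x : ∀ i, α i) => f i (x i))
    (iIndepFun_pi fun i => (hf i).aemeasurable)
    fun i => (hf i).comp (measurable_pi_apply i)).trans ?_
  exact Finset.prod_congr rfl fun i _ => (measurePreserving_eval μ i).lintegral_comp (hf i)

/-- Integrate out the seeds, then the values given the types; each stage is a product measure.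
Independence of the types factors the rest. -/
theorem lintegral_auctionLaw_prod (E : Environment n Θ)
    (hind : iIndepFun (fun (i : Fin n) (θ : ∀ i, Θ i) => θ i) E.prior) (J : Finset (Fin n))
    {f : ∀ i, Θ i × ℝ × unitInterval → ENNReal} (hf : ∀ i, Measurable (f i)) :
    ∫⁻ ω, ∏ i ∈ J, f i (ω.1.1 i, ω.1.2 i, ω.2 i) ∂E.auctionLaw
      = ∏ i ∈ J, ∫⁻ θ, ∫⁻ v, ∫⁻ r, f i (θ i, v, r) ∂volume ∂(E.F i (θ i)) ∂E.prior := by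
  have hm : Measurable fun ω : Sample Θ => ∏ i ∈ J, f i (ω.1.1 i, ω.1.2 i, ω.2 i) :=
    Finset.measurable_fun_prod _ fun i _ => (hf i).comp
      ((measurable_type_at i).prodMk ((measurable_value_at i).prodMk (measurable_seed_at i)))
  have h1 : ∀ i, Measurable fun x : Θ i × ℝ => ∫⁻ r, f i (x.1, x.2, r) := fun i =>
    Measurable.lintegral_prod_right' (f := fun y : (Θ i × ℝ) × unitInterval =>
      f i (y.1.1, y.1.2, y.2)) ((hf i).comp (by fun_prop))
  have h2 : ∀ i, Measurable fun t : Θ i => ∫⁻ v, ∫⁻ r, f i (t, v, r) ∂volume ∂(E.F i t) := fun i =>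
    Measurable.lintegral_kernel_prod_right' (κ := E.F i) (h1 i)
  have h1' : Measurable fun p : (∀ i, Θ i) × (Fin n → ℝ) =>
      ∏ i ∈ J, ∫⁻ r, f i (p.1 i, p.2 i, r) :=
    Finset.measurable_fun_prod _ fun i _ => (h1 i).comp
      (((measurable_pi_apply i).comp measurable_fst).prodMk
        ((measurable_pi_apply i).comp measurable_snd))
  rw [Environment.auctionLaw, lintegral_prod _ hm.aemeasurable]
  have e1 : ∀ p : (∀ i, Θ i) × (Fin n → ℝ),
      ∫⁻ r, ∏ i ∈ J, f i (p.1 i, p.2 i, r i) ∂(Measure.pi fun _ : Fin n =>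
        (volume : Measure unitInterval)) = ∏ i ∈ J, ∫⁻ r, f i (p.1 i, p.2 i, r) := fun p =>
    lintegral_pi_prod (fun _ : Fin n => (volume : Measure unitInterval)) J
      (f := fun i r => f i (p.1 i, p.2 i, r)) fun i => (hf i).comp (by fun_prop)
  simp only [e1]
  rw [Environment.law, Measure.lintegral_compProd h1']
  have e2 : ∀ θ : ∀ i, Θ i, ∫⁻ v, ∏ i ∈ J, ∫⁻ r, f i (θ i, v i, r) ∂volume ∂(E.valueKernel θ)
      = ∏ i ∈ J, ∫⁻ v, ∫⁻ r, f i (θ i, v, r) ∂volume ∂(E.F i (θ i)) := fun θ =>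
    lintegral_pi_prod (fun i => E.F i (θ i)) J
      (f := fun i v => ∫⁻ r, f i (θ i, v, r)) fun i => (h1 i).comp measurable_prodMk_left
  simp only [e2]
  exact lintegral_prod_eq_prod_lintegral_of_indepFun J
    (fun i (θ : ∀ i, Θ i) => ∫⁻ v, ∫⁻ r, f i (θ i, v, r) ∂volume ∂(E.F i (θ i)))
    (hind.comp (fun i t => ∫⁻ v, ∫⁻ r, f i (t, v, r) ∂volume ∂(E.F i t)) h2)
    fun i => (h2 i).comp (measurable_pi_apply i)

/-- If the types are independent, so are the triples of type, value and seed. -/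
theorem iIndepFun_triple (E : Environment n Θ)
    (hind : iIndepFun (fun (i : Fin n) (θ : ∀ i, Θ i) => θ i) E.prior) :
    iIndepFun (fun (i : Fin n) (ω : Sample Θ) => (ω.1.1 i, ω.1.2 i, ω.2 i)) E.auctionLaw := by
  classical
  rw [iIndepFun_iff_measure_inter_preimage_eq_mul]
  intro J B hB
  let B' : ∀ i, Set (Θ i × ℝ × unitInterval) := fun i => if i ∈ J then B i else Set.univ
  have hB' : ∀ i, MeasurableSet (B' i) := fun i => by
    by_cases h : i ∈ J
    · simpa [B', h] using hB i h
    · simp [B', h]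
  have hT : ∀ i, Measurable fun ω : Sample Θ => (ω.1.1 i, ω.1.2 i, ω.2 i) := fun i =>
    (measurable_type_at i).prodMk ((measurable_value_at i).prodMk (measurable_seed_at i))
  -- `K = J` gives the joint probability and singletons give its factors.
  have key : ∀ K ⊆ J,
      E.auctionLaw (⋂ i ∈ K, (fun ω : Sample Θ => (ω.1.1 i, ω.1.2 i, ω.2 i)) ⁻¹' B i)
      = ∏ i ∈ K, ∫⁻ θ, ∫⁻ v, ∫⁻ r, (B' i).indicator 1 (θ i, v, r) ∂volume
        ∂(E.F i (θ i)) ∂E.prior := by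
    intro K hK
    rw [← lintegral_auctionLaw_prod E hind K (f := fun i => (B' i).indicator 1)
      fun i => measurable_one.indicator (hB' i), ← lintegral_indicator_one]
    · refine lintegral_congr fun ω => ?_
      by_cases h : ∀ i ∈ K, (ω.1.1 i, ω.1.2 i, ω.2 i) ∈ B i
      · rw [Set.indicator_of_mem (by simpa using h), Finset.prod_eq_one]
        · rfl
        · intro i hi
          rw [Set.indicator_of_mem]
          · rfl
          · simpa [B', hK hi] using h i hi
      · rw [Set.indicator_of_notMem (by simpa using h)]
        push Not at h
        obtain ⟨i, hi, hn⟩ := h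
        rw [Finset.prod_eq_zero hi]
        rw [Set.indicator_of_notMem]
        simpa [B', hK hi] using hn
    · exact Finset.measurableSet_biInter _ fun i hi => hT i (hB i (hK hi))
  rw [key J subset_rfl]
  refine Finset.prod_congr rfl fun i hi => ?_
  have := key {i} (Finset.singleton_subset_iff.2 hi)
  simpa using this.symm

/-- The covered call values and claim prices of all bidders. -/
def callBid (E : Environment n Θ) (s : ∀ i, Strategy (Θ i)) (ω : Sample Θ) (i : Fin n) :
    ℝ × EReal :=
  (E.callValue i (ω.1.1 i) (ω.1.2 i), bidAt s ω i)

theorem measurable_callBid_at (E : Environment n Θ) (s : ∀ i, Strategy (Θ i)) (i : Fin n) :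
    Measurable fun ω => callBid E s ω i :=
  (measurable_callValue_at E i).prodMk (measurable_bidAt s i)

theorem measurable_callBid (E : Environment n Θ) (s : ∀ i, Strategy (Θ i)) :
    Measurable (callBid E s) :=
  measurable_pi_iff.2 (measurable_callBid_at E s)

theorem iIndepFun_callBid (E : Environment n Θ) (s : ∀ i, Strategy (Θ i))
    (hind : iIndepFun (fun (i : Fin n) (θ : ∀ i, Θ i) => θ i) E.prior) :
    iIndepFun (fun i ω => callBid E s ω i) E.auctionLaw :=
  (iIndepFun_triple E hind).comp
    (fun i x => (E.callValue i x.1 x.2.1, (s i).bid x.1 x.2.1 x.2.2)) fun i =>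
      ((measurable_callValue E i).comp
        (measurable_fst.prodMk (measurable_fst.comp measurable_snd))).prodMk
        (s i).measurable_bid

/-- A common law of `κ` and a common kernel `β` give all pairs `(κ i, b i)` the same law;
independence makes their joint law a power of it. -/
theorem exists_map_callBid_eq_pi (E : Environment n Θ) (s : ∀ i, Strategy (Θ i))
    (hind : iIndepFun (fun (i : Fin n) (θ : ∀ i, Θ i) => θ i) E.prior)
    (hlaw : ∀ i j, E.kappaLaw i = E.kappaLaw j) (hsym : IsSymmetric E s) (i₀ : Fin n) :
    ∃ μ : Measure (ℝ × EReal), IsProbabilityMeasure μ ∧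
      E.auctionLaw.map (callBid E s) = Measure.pi fun _ => μ := by
  obtain ⟨β, -, hβ⟩ := hsym
  have hkm : ∀ i, Measurable fun ω : Sample Θ => (E.kappa i (ω.1.1 i) (ω.1.2 i), bidAt s ω i) :=
    fun i => ((E.measurable_kappa i).comp
      ((measurable_type_at i).prodMk (measurable_value_at i))).prodMk (measurable_bidAt s i)
  have hT : Measurable fun x : EReal × EReal => (x.1.toReal, x.2) :=
    (measurable_ereal_toReal.comp measurable_fst).prodMk measurable_snd
  have hmap : ∀ i, E.auctionLaw.map (fun ω => callBid E s ω i)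
      = (E.kappaLaw i ⊗ₘ β).map fun x => (x.1.toReal, x.2) := fun i => by
    rw [← hβ i, Measure.map_map hT (hkm i)]
    congr 1
    funext ω
    simp [callBid, Environment.callValue]
  have hc : ∀ i, E.auctionLaw.map (fun ω => callBid E s ω i)
      = E.auctionLaw.map fun ω => callBid E s ω i₀ := fun i => by
    rw [hmap i, hmap i₀, hlaw i i₀]
  refine ⟨E.auctionLaw.map fun ω => callBid E s ω i₀,
    Measure.isProbabilityMeasure_map (measurable_callBid_at E s i₀).aemeasurable, ?_⟩
  have := (iIndepFun_iff_map_fun_eq_pi_map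
    fun i => (measurable_callBid_at E s i).aemeasurable).1 (iIndepFun_callBid E s hind)
  simp only [hc] at this
  exact this

end Independence

/-! ## Best responses against independent identically distributed claim prices -/

section BestResponse

/-- The probability that `n - 1` independent claim prices are at most `x`. -/
def coverProb (n : ℕ) (μ : Measure (ℝ × EReal)) (x : EReal) : ENNReal :=
  μ {z | z.2 ≤ x} ^ (n - 1)

variable {n : ℕ} {μ : Measure (ℝ × EReal)}

theorem coverProb_mono : Monotone (coverProb n μ) := fun _ _ h =>
  pow_le_pow_left' (measure_mono (Set.preimage_mono (Set.Iic_subset_Iic.2 h))) _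

theorem coverProb_le_one [IsProbabilityMeasure μ] (x : EReal) : coverProb n μ x ≤ 1 :=
  pow_le_one' prob_le_one _

theorem coverProb_ne_top [IsProbabilityMeasure μ] (x : EReal) : coverProb n μ x ≠ ⊤ :=
  ne_top_of_le_ne_top ENNReal.one_ne_top (coverProb_le_one x)

theorem measurableSet_cover (i : Fin n) {a : (Fin n → ℝ × EReal) → EReal} (ha : Measurable a) :
    MeasurableSet {z : Fin n → ℝ × EReal | ∀ j, j ≠ i → (z j).2 ≤ a z} := by
  have : {z : Fin n → ℝ × EReal | ∀ j, j ≠ i → (z j).2 ≤ a z}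
      = ⋂ (j) (_ : j ≠ i), {z | (z j).2 ≤ a z} := by ext; simp
  rw [this]
  exact MeasurableSet.iInter fun j => MeasurableSet.iInter fun _ =>
    measurableSet_le (by fun_prop) ha

open Classical in
theorem measurable_cover (i : Fin n) {f : ℝ × EReal → ENNReal} (hf : Measurable f)
    {g : ℝ × EReal → EReal} (hg : Measurable g) :
    Measurable fun z : Fin n → ℝ × EReal =>
      if ∀ j, j ≠ i → (z j).2 ≤ g (z i) then f (z i) else 0 :=
  Measurable.ite (measurableSet_cover i (hg.comp (measurable_pi_apply i)))
    (hf.comp (measurable_pi_apply i)) measurable_const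

open Classical in
-- With the pair of `i` resampled and held fixed, the event is a box with side `i` free and `n - 1`
-- equal sides.
theorem lintegral_pi_cover [IsProbabilityMeasure μ] (i : Fin n) {f : ℝ × EReal → ENNReal} (hf : Measurable f)
    {g : ℝ × EReal → EReal} (hg : Measurable g) :
    ∫⁻ z, (if ∀ j, j ≠ i → (z j).2 ≤ g (z i) then f (z i) else 0) ∂(Measure.pi fun _ : Fin n => μ)
      = ∫⁻ x, f x * coverProb n μ (g x) ∂μ := by
  have hm := measurable_cover i hf hg
  rw [lintegral_pi_update (fun _ : Fin n => μ) i hm, lintegral_lintegral_swap]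
  · refine lintegral_congr fun x => ?_
    have e : ∀ z : Fin n → ℝ × EReal,
        (if ∀ j, j ≠ i → (Function.update z i x j).2 ≤ g (Function.update z i x i) then
          f (Function.update z i x i) else 0)
        = {z : Fin n → ℝ × EReal | ∀ j, j ≠ i → (z j).2 ≤ g x}.indicator (fun _ => f x) z := by
      intro z
      have : (∀ j, j ≠ i → (Function.update z i x j).2 ≤ g (Function.update z i x i))
          ↔ z ∈ {z : Fin n → ℝ × EReal | ∀ j, j ≠ i → (z j).2 ≤ g x} := by
        simp only [Function.update_self, Set.mem_ofPred_eq]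
        exact forall₂_congr fun j hj => by rw [Function.update_of_ne hj]
      rw [Set.indicator_apply, Function.update_self]
      exact if_congr (by simpa using this) rfl rfl
    simp only [e]
    rw [lintegral_indicator_const (measurableSet_cover i measurable_const)]
    congr 1
    have : {z : Fin n → ℝ × EReal | ∀ j, j ≠ i → (z j).2 ≤ g x}
        = Set.univ.pi (fun j => if j = i then Set.univ else {y : ℝ × EReal | y.2 ≤ g x}) := by
      ext z
      simp only [Set.mem_ofPred_eq, Set.mem_pi, Set.mem_univ, true_implies]
      refine forall_congr' fun j => ?_
      by_cases hj : j = i <;> simp [hj]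
    rw [this, Measure.pi_pi, ← Finset.mul_prod_erase _ _ (Finset.mem_univ i), if_pos rfl,
      measure_univ, one_mul, Finset.prod_congr rfl fun j hj =>
        by rw [if_neg (Finset.ne_of_mem_erase hj)],
      Finset.prod_const, Finset.card_erase_of_mem (Finset.mem_univ i), Finset.card_univ,
      Fintype.card_fin, coverProb]
  · exact (hm.comp (measurable_update_prod i)).aemeasurable

/-- A monotone selection of a best response from a finite grid. -/
theorem exists_monotone_selection {h : ℝ → ℝ} (hmono : Monotone h) (D : Finset ℝ)
    (hD : ∀ y ∈ D, 0 < y) :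
    ∃ φ : ℝ → ℝ, Monotone φ ∧ (∀ k, φ k ∈ D ∨ φ k = -1) ∧ (∀ k, 0 ≤ φ k → φ k ≤ k) ∧
      ∀ k, ∀ y ∈ D, y ≤ k → 0 ≤ φ k ∧ h y * (k - y) ≤ h (φ k) * (k - φ k) := by
  classical
  -- Prices are added in increasing order, so the new one has the largest winning probability; `-1`
  -- stands for staying out.
  induction D using Finset.induction_on_max with
  | empty => exact ⟨fun _ => -1, monotone_const, by simp, fun k hk => by norm_num at hk, by simp⟩
  | insert a D ha ih =>
    obtain ⟨φ, h1, h2, h3, h4⟩ := ih fun y hy => hD y (Finset.mem_insert_of_mem hy)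
    have ha0 : 0 < a := hD a (Finset.mem_insert_self a D)
    have hmem : ∀ {k}, 0 ≤ φ k → φ k ∈ D := fun {k} hk =>
      (h2 k).resolve_right fun e => by rw [e] at hk; norm_num at hk
    -- Single crossing: as a function of the value, the payoff from `a` has the steepest slope, so
    -- the values at which `a` is preferred form an upper set. Hence the new selection stays
    -- monotone.
    have hup : ∀ {k l}, k ≤ l → a ≤ k → (0 ≤ φ k → h (φ k) * (k - φ k) ≤ h a * (k - a)) →
        (0 ≤ φ l → h (φ l) * (l - φ l) ≤ h a * (l - a)) := by
      intro k l hkl hak hc hl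
      have hz := hmem hl
      have hza := ha _ hz
      obtain ⟨hk0, hk1⟩ := h4 k _ hz (hza.le.trans hak)
      have := hc hk0
      have hh := mul_le_mul_of_nonneg_right (hmono hza.le) (sub_nonneg.2 hkl)
      nlinarith
    refine ⟨fun k => if a ≤ k ∧ (0 ≤ φ k → h (φ k) * (k - φ k) ≤ h a * (k - a)) then a else φ k,
      ?_, ?_, ?_, ?_⟩
    · intro k l hkl
      simp only
      by_cases hl : a ≤ l ∧ (0 ≤ φ l → h (φ l) * (l - φ l) ≤ h a * (l - a))
      · rw [if_pos hl]
        split_ifs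
        · exact le_rfl
        · rcases h2 k with h | h
          · exact (ha _ h).le
          · rw [h]; linarith
      · rw [if_neg hl, if_neg fun hk => hl ⟨hk.1.trans hkl, hup hkl hk.1 hk.2⟩]
        exact h1 hkl
    · intro k
      simp only
      split_ifs
      · exact Or.inl (Finset.mem_insert_self a D)
      · exact (h2 k).imp_left Finset.mem_insert_of_mem
    · intro k
      simp only
      split_ifs with hc
      · exact fun _ => hc.1
      · exact h3 k
    · intro k y hy hyk
      simp only
      split_ifs with hc
      · refine ⟨ha0.le, ?_⟩
        rcases Finset.mem_insert.1 hy with rfl | hy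
        · exact le_rfl
        · obtain ⟨h5, h6⟩ := h4 k y hy hyk
          exact h6.trans (hc.2 h5)
      · rcases Finset.mem_insert.1 hy with rfl | hy
        · have : ¬(0 ≤ φ k → h (φ k) * (k - φ k) ≤ h y * (k - y)) := fun h => hc ⟨hyk, h⟩
          push Not at this
          exact ⟨this.1, this.2.le⟩
        · exact h4 k y hy hyk

/-- The bid distribution has countably many atoms, and the complement of a countable set is dense.
Claims at these prices almost surely meet no tie. -/
theorem exists_dense_nonatoms (μ : Measure (ℝ × EReal)) [IsProbabilityMeasure μ] :
    ∃ q : ℕ → ℝ, DenseRange q ∧ ∀ m, μ {z | z.2 = (q m : EReal)} = 0 := by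
  have hc : {y : ℝ | 0 < μ {z | z.2 = (y : EReal)}}.Countable :=
    (Measure.countable_meas_level_set_pos (μ := μ) measurable_snd).preimage_of_injOn
      (f := ((↑) : ℝ → EReal)) EReal.coe_injective.injOn
  obtain ⟨t, ht, htc, htd⟩ := (hc.dense_compl ℝ).exists_countable_dense_subset
  obtain ⟨q, rfl⟩ := htc.exists_eq_range htd.nonempty
  exact ⟨q, htd, fun m => by simpa using ht ⟨m, rfl⟩⟩

/-- The payoff of claiming at price `y` when ties are won. -/
def gridValue (n : ℕ) (μ : Measure (ℝ × EReal)) (k y : ℝ) : ENNReal :=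
  ENNReal.ofReal (k - y) * coverProb n μ y

/-- The best payoff over the positive ones among the first `m` grid points. -/
def gridSup (n : ℕ) (μ : Measure (ℝ × EReal)) (q : ℕ → ℝ) (m : ℕ) (k : ℝ) : ENNReal :=
  (((Finset.range m).image q).filter (0 < ·)).sup (gridValue n μ k)

theorem measurable_gridSup (q : ℕ → ℝ) (m : ℕ) : Measurable (gridSup n μ q m) := by
  have : gridSup n μ q m
      = (((Finset.range m).image q).filter (0 < ·)).sup fun y k => gridValue n μ k y := by
    ext k; simp [gridSup, Finset.sup_apply]
  rw [this]
  refine Finset.sup_induction measurable_const (fun f hf g hg => hf.sup hg) fun y _ => ?_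
  exact (measurable_id.sub_const y).ennreal_ofReal.mul_const _

theorem gridSup_mono (q : ℕ → ℝ) (k : ℝ) : Monotone fun m => gridSup n μ q m k := fun _ _ h =>
  Finset.sup_mono (Finset.filter_subset_filter _ (Finset.image_subset_image
    (Finset.range_subset_range.2 h)))

/-- Move to a grid point slightly above `y`: the cover probability does not fall and the margin
shrinks by at most `ε`. Overbidding thus realizes the payoff of winning every tie, even if `y` is an
atom. -/
theorem gridValue_le_iSup [IsProbabilityMeasure μ] {q : ℕ → ℝ} (hq : DenseRange q) (k : ℝ) {y : ℝ} (hy : 0 ≤ y) :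
    gridValue n μ k y ≤ ⨆ m, gridSup n μ q m k := by
  rcases le_or_gt k y with hk | hk
  · rw [gridValue, ENNReal.ofReal_of_nonpos (by linarith), zero_mul]
    exact zero_le
  refine ENNReal.le_of_forall_pos_le_add fun ε hε _ => ?_
  obtain ⟨m, hm1, hm2⟩ := hq.exists_mem_open isOpen_Ioo
    (Set.nonempty_Ioo.2 (show y < min k (y + ε) from lt_min hk (by simpa using hε)))
  have h1 : gridValue n μ k (q m) ≤ ⨆ m, gridSup n μ q m k :=
    le_iSup_of_le (m + 1) (Finset.le_sup (f := gridValue n μ k) (Finset.mem_filter.2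
      ⟨Finset.mem_image_of_mem q (Finset.self_mem_range_succ m), hy.trans_lt hm1⟩))
  refine le_trans ?_ (add_le_add_left h1 _)
  have hc : coverProb n μ y ≤ coverProb n μ (q m) :=
    coverProb_mono (EReal.coe_le_coe_iff.2 hm1.le)
  have hlt := lt_min_iff.1 hm2
  have hk' : ENNReal.ofReal (k - y) ≤ ENNReal.ofReal (k - q m) + ε := by
    rw [← ENNReal.ofReal_coe_nnreal, ← ENNReal.ofReal_add (by linarith [(lt_min_iff.1 hm2).1]) ε.coe_nonneg]
    exact ENNReal.ofReal_le_ofReal (by linarith)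
  calc gridValue n μ k y ≤ (ENNReal.ofReal (k - q m) + ε) * coverProb n μ y :=
        mul_le_mul_left hk' _
    _ = ENNReal.ofReal (k - q m) * coverProb n μ y + ε * coverProb n μ y := add_mul _ _ _
    _ ≤ gridValue n μ k (q m) + ε * 1 := by
        refine add_le_add ?_ ?_
        · exact mul_le_mul_right hc _
        · exact mul_le_mul_right (coverProb_le_one _) _
    _ = _ := by rw [mul_one]

end BestResponse

/-! ## Efficiency of symmetric equilibria -/

section Symmetric

variable {n : ℕ} {Θ : Fin n → Type u} [∀ i, MeasurableSpace (Θ i)]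
variable {E : Environment n Θ} {s : ∀ i, Strategy (Θ i)}
variable {μ : Measure (ℝ × EReal)} [IsProbabilityMeasure μ]

theorem measurePreserving_callBid
    (hZ : E.auctionLaw.map (callBid E s) = Measure.pi fun _ => μ) (i : Fin n) :
    MeasurePreserving (fun ω => callBid E s ω i) E.auctionLaw μ :=
  (measurePreserving_eval (fun _ : Fin n => μ) i).comp ⟨measurable_callBid E s, hZ⟩

open Classical in
theorem lintegral_cover (hZ : E.auctionLaw.map (callBid E s) = Measure.pi fun _ => μ) (i : Fin n)
    {f : ℝ × EReal → ENNReal} (hf : Measurable f) {g : ℝ × EReal → EReal} (hg : Measurable g) :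
    ∫⁻ ω, (if ∀ j, j ≠ i → bidAt s ω j ≤ g (callBid E s ω i) then f (callBid E s ω i) else 0)
      ∂E.auctionLaw = ∫⁻ x, f x * coverProb n μ (g x) ∂μ := by
  rw [← lintegral_pi_cover i hf hg, ← hZ,
    lintegral_map (measurable_cover i hf hg) (measurable_callBid E s)]
  rfl

/-- The best response on a finite grid can be selected monotonically, so `callStrategy` implements
it without learning `κ` in advance; it cannot beat the equilibrium utility. -/
theorem lintegral_gridSup_le (hs : IsEquilibrium E s)
    (hZ : E.auctionLaw.map (callBid E s) = Measure.pi fun _ => μ) (i : Fin n)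
    {q : ℕ → ℝ} (hq : ∀ m, μ {z | z.2 = (q m : EReal)} = 0) (m : ℕ) :
    ∫⁻ x, gridSup n μ q m x.1 ∂μ
      ≤ ENNReal.ofReal (∫ ω, callPayoff E s i ω ∂E.auctionLaw) := by
  classical
  set D := ((Finset.range m).image q).filter (0 < ·) with hD
  have hmono : Monotone fun y : ℝ => (coverProb n μ y).toReal := fun x y h =>
    ENNReal.toReal_mono (coverProb_ne_top _) (coverProb_mono (EReal.coe_le_coe_iff.2 h))
  obtain ⟨φ, h1, h2, h3, h4⟩ := exists_monotone_selection hmono D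
    fun y hy => (Finset.mem_filter.1 hy).2
  have hmem : ∀ {k}, 0 ≤ φ k → φ k ∈ D := fun {k} hk =>
    (h2 k).resolve_right fun e => by rw [e] at hk; norm_num at hk
  have hφm : Measurable φ := h1.measurable
  have htie : ∀ᵐ ω ∂E.auctionLaw, ∀ j, ∀ y ∈ D, bidAt s ω j ≠ (y : EReal) := by
    refine ae_all_iff.2 fun j => (Finset.eventually_all D).2 fun y hy => ?_
    obtain ⟨l, -, rfl⟩ := Finset.mem_image.1 (Finset.mem_filter.1 hy).1
    have : ∀ᵐ z ∂μ, z.2 ≠ (q l : EReal) := by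
      rw [ae_iff]; simpa using hq l
    exact (measurePreserving_callBid hZ j).quasiMeasurePreserving.ae this
  have hφ : Measurable fun x : ℝ × unitInterval => (fun k _ => φ k) x.1 x.2 :=
    hφm.comp measurable_fst
  have hdev := (le_utility_callStrategy E s i (φ := fun k _ => φ k) hφ (fun _ => h1)
    (fun k _ => h3 k) (htie.mono fun ω h j _ x _ hx => h j _ (hmem hx))).trans (hs i _)
  rw [utility_eq_integral_payoff hs i, integral_payoff_eq hs i] at hdev
  refine le_trans ?_ (le_ofReal_of_coe_le hdev)
  have hgain : ∫⁻ ω, ENNReal.ofReal (outrightGain E s i (fun k _ => φ k) ω) ∂E.auctionLaw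
      = ∫⁻ x, ENNReal.ofReal (if 0 ≤ φ x.1 then x.1 - φ x.1 else 0)
        * coverProb n μ (φ x.1 : EReal) ∂μ := by
    rw [← lintegral_cover hZ i (f := fun x =>
      ENNReal.ofReal (if 0 ≤ φ x.1 then x.1 - φ x.1 else 0)) (g := fun x => (φ x.1 : EReal))]
    · refine lintegral_congr_ae (htie.mono fun ω h => ?_)
      simp only [outrightGain, callBid]
      by_cases h0 : 0 ≤ φ (E.callValue i (ω.1.1 i) (ω.1.2 i))
      · have : (∀ j, j ≠ i → bidAt s ω j < φ (E.callValue i (ω.1.1 i) (ω.1.2 i)))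
            ↔ ∀ j, j ≠ i → bidAt s ω j ≤ φ (E.callValue i (ω.1.1 i) (ω.1.2 i)) :=
          forall₂_congr fun j _ =>
            ⟨le_of_lt, fun hle => lt_of_le_of_ne hle (h j _ (hmem h0))⟩
        simp only [h0, true_and, this, if_true]
        split_ifs <;> simp
      · simp [h0]
    · exact (Measurable.ite (measurableSet_le measurable_const (hφm.comp measurable_fst))
        (measurable_fst.sub (hφm.comp measurable_fst)) measurable_const).ennreal_ofReal
    · exact measurable_coe_real_ereal.comp (hφm.comp measurable_fst)
  rw [hgain]
  refine lintegral_mono fun x => Finset.sup_le fun y hy => ?_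
  rcases le_or_gt x.1 y with hxy | hxy
  · rw [gridValue, ENNReal.ofReal_of_nonpos (by linarith), zero_mul]
    exact zero_le
  · obtain ⟨h5, h6⟩ := h4 x.1 y hy hxy.le
    rw [if_pos h5, gridValue, ← ENNReal.ofReal_toReal (coverProb_ne_top (n := n) (μ := μ) y),
      ← ENNReal.ofReal_toReal (coverProb_ne_top (n := n) (μ := μ) (φ x.1)),
      ← ENNReal.ofReal_mul (by linarith), ← ENNReal.ofReal_mul (by linarith [h3 _ h5])]
    refine ENNReal.ofReal_le_ofReal ?_
    rw [mul_comm, mul_comm (x.1 - φ x.1)]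
    exact h6

/-- The payoff of a bidder with covered call value `x.1` and claim price `x.2` when she wins all
ties. -/
def tieValue (n : ℕ) (μ : Measure (ℝ × EReal)) (x : ℝ × EReal) : ENNReal :=
  (if 0 ≤ x.2 ∧ x.2 ≠ ⊤ then ENNReal.ofReal (x.1 - x.2.toReal) else 0) * coverProb n μ x.2

omit [IsProbabilityMeasure μ] in
theorem tieValue_coe (k : ℝ) {y : ℝ} (hy : 0 ≤ y) :
    tieValue n μ (k, (y : EReal)) = gridValue n μ k y := by
  simp [tieValue, gridValue, hy]

theorem tieValue_le {q : ℕ → ℝ} (hq : DenseRange q) (x : ℝ × EReal) :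
    tieValue n μ x ≤ ⨆ m, gridSup n μ q m x.1 := by
  by_cases h : 0 ≤ x.2 ∧ x.2 ≠ ⊤
  · obtain ⟨k, b⟩ := x
    lift b to ℝ using ⟨h.2, fun e => by simp [e] at h⟩
    have hb : 0 ≤ b := EReal.coe_nonneg.1 h.1
    rw [tieValue_coe k hb]
    exact gridValue_le_iSup hq k hb
  · rw [tieValue, if_neg h, zero_mul]
    exact zero_le

omit [IsProbabilityMeasure μ] in
theorem measurable_coverProb : Measurable (coverProb n μ) :=
  Monotone.measurable coverProb_mono

theorem measurable_tieFactor : Measurable fun x : ℝ × EReal =>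
    if 0 ≤ x.2 ∧ x.2 ≠ ⊤ then ENNReal.ofReal (x.1 - x.2.toReal) else 0 := by
  refine Measurable.ite ?_ ?_ measurable_const
  · exact (measurableSet_le measurable_const measurable_snd).inter
      (measurable_snd (measurableSet_singleton ⊤)).compl
  · exact (measurable_fst.sub (measurable_ereal_toReal.comp measurable_snd)).ennreal_ofReal

open Classical in
/-- The payoff of bidder `i` when she wins all ties. -/
def tiePayoff (E : Environment n Θ) (s : ∀ i, Strategy (Θ i)) (i : Fin n) (ω : Sample Θ) : ℝ :=
  if 0 ≤ bidAt s ω i ∧ ∀ j, bidAt s ω j ≤ bidAt s ω i then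
    max (E.callValue i (ω.1.1 i) (ω.1.2 i) - (bidAt s ω i).toReal) 0 else 0

theorem tiePayoff_nonneg (i : Fin n) (ω : Sample Θ) : 0 ≤ tiePayoff E s i ω := by
  unfold tiePayoff; split_ifs
  · exact le_max_right _ _
  · exact le_rfl

theorem win_le_tiePayoff (i : Fin n) (ω : Sample Θ) :
    winProb (bidAt s ω) i * (E.callValue i (ω.1.1 i) (ω.1.2 i) - (bidAt s ω i).toReal)
      ≤ tiePayoff E s i ω := by
  unfold tiePayoff
  split_ifs with h
  · exact (mul_le_mul_of_nonneg_left (le_max_left _ 0) (winProb_nonneg _ _)).trans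
      (mul_le_of_le_one_left (le_max_right _ _) (winProb_le_one _ _))
  · rw [winProb_of_not h, zero_mul]

theorem ofReal_tiePayoff (i : Fin n) (ω : Sample Θ) :
    ENNReal.ofReal (tiePayoff E s i ω)
      = if ∀ j, j ≠ i → bidAt s ω j ≤ (callBid E s ω i).2 then
        (if 0 ≤ (callBid E s ω i).2 ∧ (callBid E s ω i).2 ≠ ⊤ then
          ENNReal.ofReal ((callBid E s ω i).1 - (callBid E s ω i).2.toReal) else 0) else 0 := by
  have h : (∀ j, j ≠ i → bidAt s ω j ≤ bidAt s ω i) ↔ ∀ j, bidAt s ω j ≤ bidAt s ω i := by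
    refine ⟨fun h j => ?_, fun h j _ => h j⟩
    by_cases hj : j = i
    · rw [hj]
    · exact h j hj
  simp only [tiePayoff, callBid, h, (bidAt_lt_top s ω i).ne, ne_eq, not_false_eq_true, and_true]
  by_cases h0 : 0 ≤ bidAt s ω i <;> by_cases h1 : ∀ j, bidAt s ω j ≤ bidAt s ω i
  · simp [h0, h1, ENNReal.ofReal_max]
  · simp [h0, h1]
  · simp [h0]
  · simp [h0]

theorem measurable_tiePayoff (i : Fin n) : Measurable (tiePayoff E s i) := by
  have hb := measurable_bidAt s i
  refine Measurable.ite ?_ (((measurable_callValue_at E i).sub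
    (measurable_ereal_toReal.comp hb)).max measurable_const) measurable_const
  refine (measurableSet_le measurable_const hb).inter ?_
  change MeasurableSet {ω : Sample Θ | ∀ j, bidAt s ω j ≤ bidAt s ω i}
  have : {ω : Sample Θ | ∀ j, bidAt s ω j ≤ bidAt s ω i}
      = ⋂ j, {ω | bidAt s ω j ≤ bidAt s ω i} := by ext; simp
  rw [this]
  exact MeasurableSet.iInter fun j => measurableSet_le (measurable_bidAt s j) hb

theorem lintegral_tiePayoff (hZ : E.auctionLaw.map (callBid E s) = Measure.pi fun _ => μ)
    (i : Fin n) :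
    ∫⁻ ω, ENNReal.ofReal (tiePayoff E s i ω) ∂E.auctionLaw = ∫⁻ x, tieValue n μ x ∂μ := by
  classical
  simp only [ofReal_tiePayoff]
  refine Eq.trans ?_ (lintegral_cover hZ i measurable_tieFactor measurable_snd)
  refine lintegral_congr fun ω => ?_
  congr

theorem lintegral_iSup_gridSup_le (hs : IsEquilibrium E s)
    (hZ : E.auctionLaw.map (callBid E s) = Measure.pi fun _ => μ) (i : Fin n)
    {q : ℕ → ℝ} (hq : ∀ m, μ {z | z.2 = (q m : EReal)} = 0) :
    ∫⁻ x, ⨆ m, gridSup n μ q m x.1 ∂μ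
      ≤ ENNReal.ofReal (∫ ω, callPayoff E s i ω ∂E.auctionLaw) := by
  rw [lintegral_iSup (f := fun m (x : ℝ × EReal) => gridSup n μ q m x.1)
    (fun m => (measurable_gridSup q m).comp measurable_fst)
    fun _ _ h x => gridSup_mono q x.1 h]
  exact iSup_le fun m => lintegral_gridSup_le hs hZ i hq m

/-- The pointwise bound `callPayoff ≤ tiePayoff` is an equality of integrals: the grid deviations
show that equilibrium utility is at least the value of the bids with all ties won. -/
theorem callPayoff_ae_eq_tiePayoff (hs : IsEquilibrium E s)
    (hZ : E.auctionLaw.map (callBid E s) = Measure.pi fun _ => μ) (i : Fin n) :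
    callPayoff E s i =ᵐ[E.auctionLaw] tiePayoff E s i := by
  obtain ⟨q, hq, hq0⟩ := exists_dense_nonatoms μ
  have hL : ∫⁻ ω, ENNReal.ofReal (tiePayoff E s i ω) ∂E.auctionLaw
      ≤ ENNReal.ofReal (∫ ω, callPayoff E s i ω ∂E.auctionLaw) := by
    rw [lintegral_tiePayoff hZ]
    exact (lintegral_mono fun x => tieValue_le hq x).trans (lintegral_iSup_gridSup_le hs hZ i hq0)
  have hle : ∀ ω, callPayoff E s i ω ≤ tiePayoff E s i ω := fun ω =>
    (callPayoff_le_win E s i ω).trans (win_le_tiePayoff i ω)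
  have hm : Measurable (tiePayoff E s i) := measurable_tiePayoff i
  have hT : Integrable (tiePayoff E s i) E.auctionLaw := by
    refine integrable_of_lintegral_ne_top hm (ne_top_of_le_ne_top ENNReal.ofReal_ne_top hL) ?_
    have : ∀ ω, ENNReal.ofReal (-tiePayoff E s i ω) = 0 := fun ω =>
      ENNReal.ofReal_of_nonpos (by linarith [tiePayoff_nonneg (E := E) (s := s) i ω])
    simp [this]
  have hC := integrable_callPayoff hs i
  have hCn : 0 ≤ ∫ ω, callPayoff E s i ω ∂E.auctionLaw := by
    have := utility_nonneg hs i
    rw [utility_eq_integral_payoff hs i, integral_payoff_eq hs i] at this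
    exact_mod_cast this
  rw [← ofReal_integral_eq_lintegral_ofReal hT (Filter.Eventually.of_forall (tiePayoff_nonneg i)),
    ENNReal.ofReal_le_ofReal_iff hCn] at hL
  exact (integral_eq_iff_of_ae_le hC hT (Filter.Eventually.of_forall hle)).1
    (le_antisymm (integral_mono hC hT hle) hL)

/-- The same sandwich turns optimality in expectation into optimality of almost every bid for its
own `κ`. -/
theorem tieValue_ae_eq (hs : IsEquilibrium E s)
    (hZ : E.auctionLaw.map (callBid E s) = Measure.pi fun _ => μ) (i : Fin n) {q : ℕ → ℝ}
    (hq : DenseRange q) (hq0 : ∀ m, μ {z | z.2 = (q m : EReal)} = 0) :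
    tieValue n μ =ᵐ[μ] fun x => ⨆ m, gridSup n μ q m x.1 := by
  have hU := lintegral_iSup_gridSup_le hs hZ i hq0
  have hle : ∀ x, tieValue n μ x ≤ ⨆ m, gridSup n μ q m x.1 := tieValue_le hq
  refine ae_eq_of_ae_le_of_lintegral_le (Filter.Eventually.of_forall hle)
    (ne_top_of_le_ne_top ENNReal.ofReal_ne_top ((lintegral_mono hle).trans hU))
    (Measurable.iSup fun m => (measurable_gridSup q m).comp measurable_fst).aemeasurable ?_
  refine hU.trans ?_
  have hc := callPayoff_ae_eq_tiePayoff hs hZ i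
  have hT : Integrable (tiePayoff E s i) E.auctionLaw := (integrable_callPayoff hs i).congr hc
  rw [integral_congr_ae hc, ofReal_integral_eq_lintegral_ofReal hT
    (Filter.Eventually.of_forall (tiePayoff_nonneg i)), lintegral_tiePayoff hZ]

/-- A claim price that wins does so with positive probability. -/
theorem ae_coverProb_ne_zero (hZ : E.auctionLaw.map (callBid E s) = Measure.pi fun _ => μ)
    (i : Fin n) : ∀ᵐ ω ∂E.auctionLaw,
      (∀ j, j ≠ i → bidAt s ω j ≤ bidAt s ω i) → coverProb n μ (bidAt s ω i) ≠ 0 := by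
  classical
  have hset : MeasurableSet {x : ℝ × EReal | coverProb n μ x.2 = 0} :=
    (measurable_coverProb.comp measurable_snd) (measurableSet_singleton 0)
  have h := lintegral_cover hZ i (f := {x : ℝ × EReal | coverProb n μ x.2 = 0}.indicator 1)
    (measurable_one.indicator hset) measurable_snd
  have h0 : ∫⁻ x, {x : ℝ × EReal | coverProb n μ x.2 = 0}.indicator 1 x
      * coverProb n μ x.2 ∂μ = 0 := by
    refine (lintegral_congr fun x => ?_).trans lintegral_zero
    by_cases hx : coverProb n μ x.2 = 0
    · rw [hx, mul_zero]
    · rw [Set.indicator_of_notMem (by simpa using hx), zero_mul]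
  rw [h0] at h
  replace h := (lintegral_eq_zero_iff ((measurable_cover i (measurable_one.indicator hset)
    measurable_snd).comp (measurable_callBid E s))).1 h
  filter_upwards [h] with ω hω h1 h2
  have h1' : ∀ j, j ≠ i → bidAt s ω j ≤ (callBid E s ω i).2 := h1
  have h2' : callBid E s ω i ∈ {x : ℝ × EReal | coverProb n μ x.2 = 0} := h2
  have e := (if_pos h1').symm.trans hω
  rw [Set.indicator_of_mem h2'] at e
  exact one_ne_zero e

/-- The event that all opponents' prices are at most `0` has probability exactly `coverProb n μ 0`.
-/
theorem ae_coverProb_zero_ne_zero (hZ : E.auctionLaw.map (callBid E s) = Measure.pi fun _ => μ)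
    (i : Fin n) : ∀ᵐ ω ∂E.auctionLaw,
      (∀ j, j ≠ i → bidAt s ω j ≤ 0) → coverProb n μ 0 ≠ 0 := by
  classical
  by_cases h0 : coverProb n μ 0 = 0
  · have h := lintegral_cover hZ i (f := fun _ => 1) measurable_const
      (g := fun _ => 0) measurable_const
    simp only [h0, mul_zero, lintegral_zero] at h
    replace h := (lintegral_eq_zero_iff ((measurable_cover i (f := fun _ => 1) measurable_const
      (g := fun _ => 0) measurable_const).comp (measurable_callBid E s))).1 h
    filter_upwards [h] with ω hω h1
    exact absurd ((if_pos h1).symm.trans hω) one_ne_zero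
  · exact Filter.Eventually.of_forall fun _ _ => h0

/-- The purely algebraic part of the single-crossing argument. -/
theorem le_of_single_crossing {k l b c h h' : ℝ} (hkl : k < l) (hh : h' ≤ h) (h0 : 0 < h)
    (h1 : h' * (k - c) ≤ h * (k - b)) (h2 : h * (l - b) ≤ h' * (l - c)) : b ≤ c := by
  -- Adding the two optimality inequalities gives `(h - h') (l - k) ≤ 0`.
  have e : h = h' := le_antisymm (by nlinarith) hh
  subst e
  linarith [le_of_mul_le_mul_left h1 h0]

/-- A winner's covered call value is the highest one, and it is nonnegative. -/
theorem ae_winner_best (hs : IsEquilibrium E s)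
    (hZ : E.auctionLaw.map (callBid E s) = Measure.pi fun _ => μ) (i : Fin n) :
    ∀ᵐ ω ∂E.auctionLaw, winProb (bidAt s ω) i ≠ 0 →
      E.bestCall ω.1 ≤ E.callValue i (ω.1.1 i) (ω.1.2 i) := by
  obtain ⟨q, hq, hq0⟩ := exists_dense_nonatoms μ
  have hval : ∀ᵐ ω ∂E.auctionLaw, ∀ j, tieValue n μ (callBid E s ω j)
      = ⨆ m, gridSup n μ q m (E.callValue j (ω.1.1 j) (ω.1.2 j)) :=
    ae_all_iff.2 fun j => (measurePreserving_callBid hZ j).quasiMeasurePreserving.ae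
      (tieValue_ae_eq hs hZ j hq hq0)
  have htie : ∀ᵐ ω ∂E.auctionLaw, ∀ j, callPayoff E s j ω = tiePayoff E s j ω :=
    ae_all_iff.2 fun j => callPayoff_ae_eq_tiePayoff hs hZ j
  filter_upwards [hval, htie, ae_coverProb_ne_zero hZ i] with ω hval htie hpos hwin
  obtain ⟨hi0, hi⟩ := of_winProb_ne_zero hwin
  set k : Fin n → ℝ := fun j => E.callValue j (ω.1.1 j) (ω.1.2 j) with hk
  set b : Fin n → ℝ := fun j => (bidAt s ω j).toReal with hb
  -- This quantity lies between `callPayoff` and `tiePayoff`, which agree here.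
  have hw : ∀ j, winProb (bidAt s ω) j * (k j - b j) = tiePayoff E s j ω := fun j =>
    le_antisymm (win_le_tiePayoff j ω) (htie j ▸ callPayoff_le_win E s j ω)
  have hmax : ∀ j, 0 ≤ bidAt s ω j → (∀ l, bidAt s ω l ≤ bidAt s ω j) →
      winProb (bidAt s ω) j * (k j - b j) = max (k j - b j) 0 := fun j h1 h2 => by
    rw [hw j, tiePayoff, if_pos ⟨h1, h2⟩]
  have hkb : ∀ j, 0 ≤ bidAt s ω j → (∀ l, bidAt s ω l ≤ bidAt s ω j) → b j ≤ k j := by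
    intro j h1 h2
    have hp := winProb_pos ⟨h1, h2⟩
    have h3 := hmax j h1 h2
    by_contra hlt
    push Not at hlt
    have := mul_neg_of_pos_of_neg hp (sub_neg.2 hlt)
    linarith [le_max_right (k j - b j) 0]
  -- Sharing a tie costs a fraction of the margin `k j - b j`, so equality with `tiePayoff` leaves
  -- no margin.
  have htb : ∀ j, 0 ≤ bidAt s ω j → (∀ l, bidAt s ω l ≤ bidAt s ω j) →
      winProb (bidAt s ω) j < 1 → k j = b j := by
    intro j h1 h2 h3
    have h4 := hkb j h1 h2
    have h5 := hmax j h1 h2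
    rw [max_eq_left (sub_nonneg.2 h4)] at h5
    by_contra hne
    have : 0 < k j - b j := sub_pos.2 (lt_of_le_of_ne h4 (Ne.symm hne))
    nlinarith
  have hbi : ((b i : ℝ) : EReal) = bidAt s ω i := coe_toReal_bidAt hi0
  have hbi0 : 0 ≤ b i := toReal_bidAt_nonneg s ω i
  have hki := hkb i hi0 hi
  have hH : coverProb n μ (b i) ≠ 0 := by
    rw [hbi]; exact hpos fun j _ => hi j
  have hHt := ENNReal.toReal_pos hH (coverProb_ne_top _)
  have hopt : ∀ j y, 0 ≤ y → gridValue n μ (k j) y ≤ tieValue n μ (callBid E s ω j) :=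
    fun j y hy => by rw [hval j]; exact gridValue_le_iSup hq _ hy
  have hgrid : ∀ j, 0 ≤ bidAt s ω j →
      tieValue n μ (callBid E s ω j) = gridValue n μ (k j) (b j) := fun j hj => by
    rw [← tieValue_coe (k j) (toReal_bidAt_nonneg s ω j), coe_toReal_bidAt hj]
    rfl
  have hbest : ∀ j, k j ≤ k i := by
    intro j
    by_contra hlt
    push Not at hlt
    have hji : j ≠ i := fun e => by rw [e] at hlt; exact lt_irrefl _ hlt
    rcases (hi j).eq_or_lt with heq | hblt
    · have e1 := htb i hi0 hi (winProb_lt_one hji heq)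
      have e2 := htb j (heq ▸ hi0) (fun l => heq ▸ hi l) (winProb_lt_one hji.symm heq.symm)
      have : b j = b i := by simp only [hb, heq]
      linarith
    -- A bidder `j` with a higher `κ` and a lower bid could gain at price `b i`, so she does claim
    -- at some price. Optimality of both bids and single crossing then give `b i ≤ b j`, a
    -- contradiction.
    · have hpj : 0 < gridValue n μ (k j) (b i) :=
        ENNReal.mul_pos (by simpa using by linarith) hH
      have hj0 : 0 ≤ bidAt s ω j := by
        refine (bidAt_eq_bot_or s ω j).resolve_left fun e => ?_
        have := hpj.trans_le (hopt j (b i) hbi0)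
        simp [tieValue, callBid, e] at this
      have hbj : ((b j : ℝ) : EReal) = bidAt s ω j := coe_toReal_bidAt hj0
      have hbj0 : 0 ≤ b j := toReal_bidAt_nonneg s ω j
      have hbb : b j < b i := by
        rw [← EReal.coe_lt_coe_iff, hbj, hbi]; exact hblt
      have o1 := hopt j (b i) hbi0
      have o2 := hopt i (b j) hbj0
      rw [hgrid j hj0] at o1
      rw [hgrid i hi0] at o2
      have real : ∀ x y z w : ℝ, 0 ≤ x - y → 0 ≤ z - w → gridValue n μ x y ≤ gridValue n μ z w →
          (coverProb n μ y).toReal * (x - y) ≤ (coverProb n μ w).toReal * (z - w) := by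
        intro x y z w hxy hzw h
        have := ENNReal.toReal_mono
          (ENNReal.mul_ne_top ENNReal.ofReal_ne_top (coverProb_ne_top _)) h
        simp only [gridValue, ENNReal.toReal_mul, ENNReal.toReal_ofReal hxy,
          ENNReal.toReal_ofReal hzw] at this
        linarith
      have r1 := real _ _ _ _ (by linarith) (by linarith) o1
      have r2 := real _ _ _ _ (by linarith) (by linarith) o2
      have := le_of_single_crossing hlt (ENNReal.toReal_mono (coverProb_ne_top _)
        (coverProb_mono (EReal.coe_le_coe_iff.2 hbb.le))) hHt r2 r1
      linarith
  rcases bestCall_eq_zero_or E ω.1 with h | ⟨j, -, h⟩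
  · rw [h]; exact hbi0.trans hki
  · rw [h]; exact hbest j

/-- If nobody claims the item, no covered call value is positive. -/
theorem ae_unsold (hs : IsEquilibrium E s)
    (hZ : E.auctionLaw.map (callBid E s) = Measure.pi fun _ => μ) :
    ∀ᵐ ω ∂E.auctionLaw, (∀ i, bidAt s ω i < 0) → E.bestCall ω.1 = 0 := by
  obtain ⟨q, hq, hq0⟩ := exists_dense_nonatoms μ
  have hval : ∀ᵐ ω ∂E.auctionLaw, ∀ j, tieValue n μ (callBid E s ω j)
      = ⨆ m, gridSup n μ q m (E.callValue j (ω.1.1 j) (ω.1.2 j)) :=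
    ae_all_iff.2 fun j => (measurePreserving_callBid hZ j).quasiMeasurePreserving.ae
      (tieValue_ae_eq hs hZ j hq hq0)
  filter_upwards [hval, ae_all_iff.2 fun i => ae_coverProb_zero_ne_zero hZ i] with ω hval h0 hneg
  refine (bestCall_eq_zero_or E ω.1).resolve_right ?_
  rintro ⟨i, hi, -⟩
  -- With `κ > 0`, the value at price `0` is positive, whereas never claiming yields `0`, against
  -- the optimality of the bid.
  have h1 : gridValue n μ (E.callValue i (ω.1.1 i) (ω.1.2 i)) 0
      ≤ tieValue n μ (callBid E s ω i) := by
    rw [hval i]; exact gridValue_le_iSup hq _ le_rfl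
  have h2 : tieValue n μ (callBid E s ω i) = 0 := by
    rw [tieValue, if_neg, zero_mul]
    exact fun h => (hneg i).not_ge h.1
  have h3 : 0 < gridValue n μ (E.callValue i (ω.1.1 i) (ω.1.2 i)) 0 :=
    ENNReal.mul_pos (by simpa using hi) (h0 i fun j _ => (hneg j).le)
  exact (h3.trans_le h1).ne' h2

/-- With no amortization loss, utilities and payments add up to `∑ A κ`. The weights `A` sum to `1`
and sit on bidders with the highest `κ` whenever the item is sold. -/
theorem auctionWelfare_ge_of_iid (hs : IsEquilibrium E s)
    (hZ : E.auctionLaw.map (callBid E s) = Measure.pi fun _ => μ) :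
    ((∫ p, E.bestCall p ∂E.law : ℝ) : EReal) ≤ auctionWelfare E s := by
  have hi : ∀ i, Integrable (fun ω => callPayoff E s i ω
      + winProb (bidAt s ω) i * (bidAt s ω i).toReal) E.auctionLaw := fun i =>
    (integrable_callPayoff hs i).add (integrable_payment hs i)
  have hsum : ∑ i, (∫ ω, payoff E s i ω ∂E.auctionLaw
      + ∫ ω, winProb (bidAt s ω) i * (bidAt s ω i).toReal ∂E.auctionLaw)
      = ∫ ω, ∑ i, (callPayoff E s i ω
        + winProb (bidAt s ω) i * (bidAt s ω i).toReal) ∂E.auctionLaw := by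
    rw [integral_finsetSum _ fun i _ => hi i]
    exact Finset.sum_congr rfl fun i _ => by
      rw [integral_payoff_eq hs i,
        integral_add (integrable_callPayoff hs i) (integrable_payment hs i)]
  rw [auctionWelfare_eq hs, hsum, EReal.coe_le_coe_iff, ← integral_bestCall_auctionLaw]
  refine integral_mono_ae (integrable_bestCall E _) (integrable_finsetSum _ fun i _ => hi i) ?_
  filter_upwards [ae_all_iff.2 fun i => callPayoff_ae_eq_tiePayoff hs hZ i,
    ae_all_iff.2 fun i => ae_winner_best hs hZ i, ae_unsold hs hZ] with ω h1 h2 h3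
  have hterm : ∀ i, winProb (bidAt s ω) i * E.bestCall ω.1 ≤ callPayoff E s i ω
      + winProb (bidAt s ω) i * (bidAt s ω i).toReal := by
    intro i
    have hw : callPayoff E s i ω = winProb (bidAt s ω) i *
        (E.callValue i (ω.1.1 i) (ω.1.2 i) - (bidAt s ω i).toReal) :=
      le_antisymm (callPayoff_le_win E s i ω) (h1 i ▸ win_le_tiePayoff i ω)
    rw [hw, ← mul_add, sub_add_cancel]
    by_cases h0 : winProb (bidAt s ω) i = 0
    · rw [h0, zero_mul, zero_mul]
    · exact mul_le_mul_of_nonneg_left (h2 i h0) (winProb_nonneg _ _)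
  refine le_trans ?_ (Finset.sum_le_sum fun i _ => hterm i)
  rw [← Finset.sum_mul]
  rcases winProb_eq_zero_or_exists_max (bidAt s ω) with h | ⟨i, hi⟩
  · rw [h3 fun i => (h i).2, mul_zero]
  · rw [sum_winProb hi, one_mul]

end Symmetric

/-- Symmetric equilibria are efficient if types are independent and the covered call values are
identically distributed. -/
theorem isEfficient_of_isSymmetric {n : ℕ} {Θ : Fin n → Type u} [∀ i, MeasurableSpace (Θ i)]
    (E : Environment n Θ) (hlaw : ∀ i j, E.kappaLaw i = E.kappaLaw j)
    (hind : iIndepFun (fun (i : Fin n) (θ : ∀ i, Θ i) => θ i) E.prior)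
    (s : ∀ i, Strategy (Θ i)) (hs : IsEquilibrium E s) (hsym : IsSymmetric E s) :
    IsEfficient E s := by
  refine (optimalWelfare_le E).trans ?_
  -- Without bidders there is nobody to supply the common law `μ`, but both sides are then zero.
  rcases Nat.eq_zero_or_pos n with rfl | hn
  · have hb : ∀ p, E.bestCall p = 0 := fun p =>
      (bestCall_eq_zero_or E p).resolve_right fun ⟨i, _⟩ => i.elim0
    simp [hb, auctionWelfare, expect]
  · obtain ⟨μ, _, hZ⟩ := exists_map_callBid_eq_pi E s hind hlaw hsym ⟨0, hn⟩
    exact auctionWelfare_ge_of_iid hs hZ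

end DutchInspection

end
open DutchInspection in
theorem corollary2 {n : ℕ} {Θ : Fin n → Type*} [∀ i, MeasurableSpace (Θ i)]
    (E : Environment n Θ) :
    ((∀ i j, E.kappaLaw i = E.kappaLaw j) →
      iIndepFun (fun (i : Fin n) (θ : ∀ i, Θ i) => θ i) E.prior →
      ∀ s : ∀ i, Strategy (Θ i), IsEquilibrium E s → IsSymmetric E s → IsEfficient E s) ∧
    (∀ s : ∀ i, Strategy (Θ i), IsEquilibrium E s →
      ((1 - 1 / Real.exp 1 : ℝ) : EReal) * optimalWelfare E ≤ auctionWelfare E s) := by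
  refine ⟨fun hlaw hind s hs hsym => isEfficient_of_isSymmetric E hlaw hind s hs hsym,
    fun s hs => le_trans ?_ (auctionWelfare_ge hs)⟩
  rw [EReal.coe_mul]
  refine mul_le_mul_of_nonneg_left (optimalWelfare_le E) ?_
  have : 0 ≤ 1 - 1 / Real.exp 1 := by
    rw [sub_nonneg, div_le_one (Real.exp_pos 1)]
    exact Real.one_le_exp zero_le_one
  exact_mod_cast this
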